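/- Let $\beta>0$ and $\nu(z)=\max\{1,z\}$ for $z\ge 0$, and let $\varphi(s,t)=|t|\,\nu(|s/t|)$ for $t\neq 0$, $\varphi(s,0)=|s|$ (so $\varphi(s,t)=\max\{|s|,|t|\}$). For a compact connected set $\Omega\subset\mathbb{R}^2$ and a smooth function $u:\Omega\to\mathbb{R}$, the maximum ($L^\infty$) amoeba distance of $p,q\in\Omega$ is $$d(p,q)=\inf_{c}\int_0^1\varphi\bigl(\|c'(t)\|_2,\ \beta\,|(u\circ c)'(t)|\bigr)\,dt ,$$ where $c$ runs over the regular ($C^1$ with nowhere vanishing derivative) curves $c:[0,1]\to\Omega$ with $c(0)=p$, $c(1)=q$. The amoeba with radius $\varrho>0$ and reference point $x_0\in\Omega$ is $\mathcal{A}_\varrho(x_0)=\{q\in\Omega : d(x_0,q)\le\varrho\}$. A median of $u$ within $\mathcal{A}_\varrho(x_0)$ is a number $m$ such that neither $\{x\in\mathcal{A}_\varrho(x_0):u(x)<m\}$ nor $\{x\in\mathcal{A}_\varrho(x_0):u(x)>m\}$ has more than half of the area of $\mathcal{A}_\varrho(x_0)$. A function $g:[0,\infty)\to[0,\infty)$ that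 is continuous, weakly decreasing and differentiable on $(0,\infty)$ is called an edge-stopping function associated with amoeba median filtering for this metric if amoeba median filtering with radius $\varrho$ approximates, for $\varrho\to 0$, a time step of size $\varrho^2/6$ of the self-snakes equation $u_t=|\nabla u|\operatorname{div}\bigl(g(|\nabla u|)\,\nabla u/|\nabla u|\bigr)$. This means: for all $\Omega$ and $u$ as above and every interior point $x_0$ of $\Omega$ with $\nabla u(x_0)\ne 0$, for all sufficiently small $\varrho>0$ medians of $u$ within $\mathcal{A}_\varrho(x_0)$ exist, and all of them satisfy $$m=u(x_0)+\frac{\varrho^2}{6}\,|\nabla u|\operatorname{div}\Bigl(g(|\nabla u|)\,\frac{\nabla u}{|\nabla u|}\Bigr)(x_0)+o(\varrho^2)\qquad(\varrho\to 0).$$ Then there is exactly one such edge-stopping function, namely $$g_\infty(z)=\begin{cases}1, & \beta z\le 1,\\[2pt] 1-\Bigl(1-\dfrac{1}{\beta^2z^2}\Bigr)^{3/2}, & \beta z>1.\end{cases}$$ Moreover, for every $z>0$, $$g_\infty(z)=\frac{3}{\beta^2z^2\,\nu\bigl(\tfrac{1}{\beta z}\bigr)^3}\int_0^1\xi^2\sqrt{\Bigl(\nu^{-1}\bigl(\tfrac1\xi\,\nu(\tfrac1{\beta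 z})\bigr)\Bigr)^2-\frac1{\beta^2z^2}}\;d\xi ,$$ where the integrand is integrable and $\nu^{-1}$ is the inverse of $\nu$ (the argument is greater than $1$ for $0<\xi<1$, and there $\nu^{-1}(w)=w$). -/

import Mathlib

namespace Amoeba

open MeasureTheory Set Filter Topology
open scoped ENNReal ContDiff

noncomputable section

/-- The Euclidean plane that contains the image domain. -/
abbrev Plane : Type := EuclideanSpace ℝ (Fin 2)

/-- The function `ν` of the maximum (`L^∞`) amoeba metric. -/
def nuInf (z : ℝ) : ℝ := max 1 z

/-- The norm `φ` on `ℝ²` built from `ν`; it combines spatial distances `s` with rescaled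
contrasts `t`. -/
def phi (ν : ℝ → ℝ) (s t : ℝ) : ℝ :=
  if t = 0 then |s| else |t| * ν |s / t|

/-- `c`, restricted to `[0,1]`, is a regular curve in `Ω` from `p` to `q`:
continuously differentiable with nowhere vanishing derivative. -/
structure IsRegularCurve (Ω : Set Plane) (p q : Plane) (c : ℝ → Plane) : Prop where
  contDiffOn : ContDiffOn ℝ 1 c (Icc 0 1)
  deriv_ne_zero : ∀ t ∈ Icc (0 : ℝ) 1, derivWithin c (Icc 0 1) t ≠ 0
  mapsTo : MapsTo c (Icc 0 1) Ω
  source : c 0 = p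
  target : c 1 = q

/-- The amoeba length `∫₀¹ φ(‖c'(t)‖, β |(f ∘ c)'(t)|) dt` of a curve `c`. -/
def curveLength (ν : ℝ → ℝ) (β : ℝ) (f : Plane → ℝ) (c : ℝ → Plane) : ℝ≥0∞ :=
  ∫⁻ t in Icc (0 : ℝ) 1, ENNReal.ofReal
    (phi ν ‖derivWithin c (Icc 0 1) t‖ (β * |derivWithin (f ∘ c) (Icc 0 1) t|))

/-- The amoeba distance on the image `f` over `Ω`: the infimum of the amoeba lengths of the
regular curves in `Ω` that join `p` and `q` (`∞` if there are none). -/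
def amoebaDist (ν : ℝ → ℝ) (β : ℝ) (Ω : Set Plane) (f : Plane → ℝ) (p q : Plane) : ℝ≥0∞ :=
  ⨅ (c : ℝ → Plane) (_ : IsRegularCurve Ω p q c), curveLength ν β f c

/-- The amoeba with radius `ρ` and reference point `x₀`. -/
def amoeba (ν : ℝ → ℝ) (β : ℝ) (Ω : Set Plane) (f : Plane → ℝ) (ρ : ℝ) (x₀ : Plane) :
    Set Plane :=
  {q ∈ Ω | amoebaDist ν β Ω f x₀ q ≤ ENNReal.ofReal ρ}

/-- `m` is a median of `u` within `A` with respect to area: neither the part of `A` where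
`u < m` nor the part where `u > m` has more than half of the area of `A`. -/
def IsMedian (u : Plane → ℝ) (A : Set Plane) (m : ℝ) : Prop :=
  volume {x ∈ A | u x < m} ≤ volume A / 2 ∧ volume {x ∈ A | m < u x} ≤ volume A / 2

/-- The divergence of a planar vector field. -/
def divergence (F : Plane → Plane) (x : Plane) : ℝ :=
  ∑ i : Fin 2, fderiv ℝ F x (EuclideanSpace.single i 1) i

/-- The right-hand side `|∇u| div(g(|∇u|) ∇u / |∇u|)` of the self-snakes equation. -/
def selfSnakes (g : ℝ → ℝ) (u : Plane → ℝ) (x : Plane) : ℝ :=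
  ‖gradient u x‖ *
    divergence (fun y => (g ‖gradient u y‖ / ‖gradient u y‖) • gradient u y) x

/-- One iteration of amoeba median filtering of `u` over `Ω` approximates at `x₀`, for `ρ → 0`,
an explicit time step of size `ρ² / 6` of the equation `u_t = r`, where `r` is the value of the
right-hand side at `x₀`: for small `ρ > 0`, the median of `u` within the amoeba exists, and it is
`u(x₀) + (ρ² / 6) r + o(ρ²)`. -/
def ApproximatesTimeStep (ν : ℝ → ℝ) (β : ℝ) (Ω : Set Plane) (u : Plane → ℝ) (x₀ : Plane)
    (r : ℝ) : Prop :=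
  ∀ ε > 0, ∀ᶠ ρ : ℝ in 𝓝[>] 0,
    (∃ m, IsMedian u (amoeba ν β Ω u ρ x₀) m) ∧
    ∀ m, IsMedian u (amoeba ν β Ω u ρ x₀) m → |m - (u x₀ + ρ ^ 2 / 6 * r)| ≤ ε * ρ ^ 2

/-- `g`, as a function on `[0, ∞)`, is an edge-stopping function associated with amoeba median
filtering for the amoeba metric given by `ν` and the contrast scale `β`: it is nonnegative,
decreasing (in the weak sense), continuous, differentiable on `(0, ∞)`, and amoeba median
filtering of every smooth image approximates the self-snakes equation with `g` at every interior
point of the image domain with nonvanishing gradient (at zeros of the gradient the right-hand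
side of the equation is not defined). -/
structure IsEdgeStoppingFunction (ν : ℝ → ℝ) (β : ℝ) (g : ℝ → ℝ) : Prop where
  nonneg : ∀ z, 0 ≤ z → 0 ≤ g z
  antitoneOn : AntitoneOn g (Ici 0)
  continuousOn : ContinuousOn g (Ici 0)
  differentiableOn : DifferentiableOn ℝ g (Ioi 0)
  approximates : ∀ (Ω : Set Plane) (u : Plane → ℝ), IsCompact Ω → IsConnected Ω →
    ContDiffOn ℝ ∞ u Ω → ∀ x₀ ∈ interior Ω, gradient u x₀ ≠ 0 →
      ApproximatesTimeStep ν β Ω u x₀ (selfSnakes g u x₀)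

/-- The inverse of `ν : [0, ∞) → (0, ∞)`. For `ν = max{1, z}` it takes the only possible value at
every argument greater than `1`. -/
def nuInv (ν : ℝ → ℝ) : ℝ → ℝ := Function.invFunOn ν (Ici 0)

/-- The integrand `ξ² √(ν⁻²(ν(1/(βz)) / ξ) - 1/(β²z²))`, with `ν⁻²` the square of the inverse. -/
def nuIntegrand (ν : ℝ → ℝ) (β z ξ : ℝ) : ℝ :=
  ξ ^ 2 * √(nuInv ν (1 / ξ * ν (1 / (β * z))) ^ 2 - 1 / (β ^ 2 * z ^ 2))

/-- The closed form for the maximum amoeba metric. -/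
def gInf (β z : ℝ) : ℝ :=
  if β * z ≤ 1 then 1 else 1 - (1 - 1 / (β ^ 2 * z ^ 2)) ^ (3 / 2 : ℝ)

end

end Amoeba

namespace Amoeba

open MeasureTheory Set Filter Topology
open scoped ENNReal ContDiff

/-! ### The closed form of the edge-stopping function -/

/-! Every curve from `x₀` to `q` has amoeba length at least `max ‖q - x₀‖ (β |u q - u x₀|)`, so the
amoeba lies in a disk of radius `ρ` cut by a curved strip around the level line through `x₀`
(`amoeba_subset`). Conversely, a straight segment shows that a point of this cut disk belongs to the
amoeba if along the whole segment the amoeba speed is at most `ρ`, or if the contrast term dominates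
with constant sign. The only other points, apart from the centre, lie near the corners where strip
and circle meet (`framePoint_mem_amoeba`), and their share of the area is negligible.

With `z = |∇u(x₀)|`, `κ = 1/(βz)` and coordinates scaled by `ρ` in a frame whose first vector is
`∇u/|∇u|`, the function `(u - u(x₀))/(zρ)` is `x + ρ q(x, y) + o(ρ)` for a quadratic form `q = Ax² +
Bxy + Cy²`, and the strip is `|·| ≤ κ`. Let `F(τ)` be the area of the part of the unit disk where `x
+ ρ q ≤ τ`. The median level `ρσ` solves `2 (F(ρσ) - F(-κ)) = F(κ) - F(-κ)`. At order zero this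
holds by symmetry of the disk; at order one, by `tendsto_volume_diskPart`, it gives `σ = C (1 -
Y³)/3 - Y A κ²` with `Y = √(1 - κ²)` (`exists_volume_lt`). In terms of the Hessian the coefficient
of `ρ²/6` is `(1 - Y³) u_ξξ - 3κ²Y u_ηη`, with `η` along the gradient and `ξ` along the level line.
Since the self-snakes operator is `g u_ξξ + z g' u_ηη` (`selfSnakes_eq`), `g = 1 - Y³` fits both
terms. The truncated root makes `Y = 0` for `κ ≥ 1`, when the strip does not cut the disk to leading
order.

For uniqueness, medians determine the second order coefficient, and a parabolic test image turns
this coefficient into `g z`; continuity settles `z = 0`. The integral formula follows from an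
explicit antiderivative. -/

theorem sqrt_pow_three (t : ℝ) : √t ^ 3 = t * √t := by
  rcases le_total 0 t with h | h
  · rw [pow_succ, Real.sq_sqrt h]
  · simp [Real.sqrt_eq_zero'.2 h]

/-- The slope at `0` is `√t`, which tends to `0`. Thus the truncated power is differentiable across
its kink, and with it `gInf` at `β z = 1`. -/
theorem hasDerivAt_sqrt_pow_three (t : ℝ) :
    HasDerivAt (fun t : ℝ => √t ^ 3) (3 / 2 * √t) t := by
  rcases eq_or_ne t 0 with rfl | ht
  · rw [hasDerivAt_iff_tendsto_slope]
    have h : Tendsto (fun t : ℝ => √t) (𝓝[≠] 0) (𝓝 √0) :=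
      (Real.continuous_sqrt.tendsto 0).mono_left nhdsWithin_le_nhds
    simp only [Real.sqrt_zero, mul_zero] at h ⊢
    refine h.congr' ?_
    filter_upwards [self_mem_nhdsWithin] with t ht
    have ht : t ≠ 0 := ht
    simp only [slope_def_field, sqrt_pow_three]
    field_simp
    simp
  · refine ((Real.hasDerivAt_sqrt ht).pow 3).congr_deriv ?_
    rcases lt_or_gt_of_ne ht with h | h
    · simp [Real.sqrt_eq_zero'.2 h.le]
    · have := Real.sqrt_pos.2 h
      field_simp
      push_cast
      ring

theorem gInf_of_le {β z : ℝ} (h : β * z ≤ 1) : gInf β z = 1 := if_pos h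

/-- For `β z ≤ 1` the radicand is nonpositive and its root is `0` by convention, so both branches
merge into one formula. -/
theorem gInf_eq {β z : ℝ} (hβ : 0 < β) (hz : 0 < z) :
    gInf β z = 1 - √(1 - 1 / (β ^ 2 * z ^ 2)) ^ 3 := by
  unfold gInf
  split_ifs with h
  · have h1 : (β * z) ^ 2 ≤ 1 := pow_le_one₀ (by positivity) h
    rw [Real.sqrt_eq_zero'.2]
    · simp
    · rw [sub_nonpos, ← mul_pow, le_div_iff₀ (by positivity)]
      linarith
  · have h1 : 1 ≤ (β * z) ^ 2 := one_le_pow₀ (not_le.1 h).le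
    have h2 : 0 ≤ 1 - 1 / (β ^ 2 * z ^ 2) := by
      rw [sub_nonneg, ← mul_pow]
      exact div_le_one_of_le₀ h1 (by positivity)
    have h3 := Real.rpow_mul_natCast h2 (1 / 2) 3
    rw [Real.sqrt_eq_rpow, ← h3]
    norm_num

theorem hasDerivAt_gInf {β z : ℝ} (hβ : 0 < β) (hz : 0 < z) :
    HasDerivAt (gInf β) (-(3 * √(1 - 1 / (β ^ 2 * z ^ 2)) / (β ^ 2 * z ^ 3))) z := by
  have h1 : HasDerivAt (fun z : ℝ => 1 - 1 / (β ^ 2 * z ^ 2)) (2 / (β ^ 2 * z ^ 3)) z := by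
    have h := (((hasDerivAt_pow 2 z).const_mul (β ^ 2)).inv (by positivity)).const_sub 1
    simp only [one_div]
    refine h.congr_deriv ?_
    field_simp
    push_cast
    ring
  have h2 := ((hasDerivAt_sqrt_pow_three _).comp z h1).const_sub 1
  refine (h2.congr_of_eventuallyEq ?_).congr_deriv ?_
  · filter_upwards [lt_mem_nhds hz] with w hw
    exact gInf_eq hβ hw
  · ring

theorem gInf_nonneg {β z : ℝ} (hβ : 0 < β) (hz : 0 ≤ z) : 0 ≤ gInf β z := by
  rcases hz.eq_or_lt with rfl | hz
  · simp [gInf]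
  · rw [gInf_eq hβ hz, sub_nonneg]
    refine pow_le_one₀ (Real.sqrt_nonneg _) (Real.sqrt_le_one.2 ?_)
    have : 0 ≤ 1 / (β ^ 2 * z ^ 2) := by positivity
    linarith

theorem antitoneOn_gInf {β : ℝ} (hβ : 0 < β) : AntitoneOn (gInf β) (Ici 0) := by
  intro x hx y hy hxy
  rcases (mem_Ici.1 hx).eq_or_lt with rfl | hx
  · rw [gInf_of_le (z := 0) (by simp)]
    rcases (mem_Ici.1 hy).eq_or_lt with rfl | hy
    · simp [gInf]
    · rw [gInf_eq hβ hy]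
      have : 0 ≤ √(1 - 1 / (β ^ 2 * y ^ 2)) ^ 3 := by positivity
      linarith
  · rw [gInf_eq hβ hx, gInf_eq hβ (hx.trans_le hxy)]
    gcongr

theorem gInf_eventuallyEq_one {β : ℝ} (hβ : 0 < β) : gInf β =ᶠ[𝓝 0] fun _ => 1 := by
  filter_upwards [gt_mem_nhds (show (0 : ℝ) < 1 / β by positivity)] with z hz
  rw [lt_div_iff₀ hβ] at hz
  exact gInf_of_le (by linarith)

theorem continuousAt_gInf {β z : ℝ} (hβ : 0 < β) (hz : 0 ≤ z) : ContinuousAt (gInf β) z := by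
  rcases hz.eq_or_lt with rfl | hz
  · exact continuousAt_const.congr (gInf_eventuallyEq_one hβ).symm
  · exact (hasDerivAt_gInf hβ hz).continuousAt

/-! ### The integral representation -/

theorem nuInv_nuInf {w : ℝ} (hw : 1 < w) : nuInv nuInf w = w := by
  have hex : ∃ a ∈ Ici (0 : ℝ), nuInf a = w :=
    ⟨w, (zero_lt_one.trans hw).le, max_eq_right hw.le⟩
  have h : nuInf (nuInv nuInf w) = w := Function.invFunOn_eq hex
  rcases max_choice 1 (nuInv nuInf w) with h' | h' <;> linarith [h'.symm.trans h]

/-- One factor `ξ` moves under the root, which removes the singularity at `ξ = 0` and leaves an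
elementary integrand. The endpoints are excluded because there the argument of the inverse need not
exceed `1`. -/
theorem nuIntegrand_eq {β z ξ : ℝ} (hξ : ξ ∈ Ioo (0 : ℝ) 1) :
    nuIntegrand nuInf β z ξ =
      ξ * √(nuInf (1 / (β * z)) ^ 2 - 1 / (β ^ 2 * z ^ 2) * ξ ^ 2) := by
  obtain ⟨h0, h1⟩ := hξ
  have hν : 1 ≤ nuInf (1 / (β * z)) := le_max_left _ _
  have hw : 1 < 1 / ξ * nuInf (1 / (β * z)) := by
    have : 1 < 1 / ξ := by rwa [lt_div_iff₀ h0, one_mul]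
    nlinarith
  rw [nuIntegrand, nuInv_nuInf hw]
  set μ := nuInf (1 / (β * z))
  have h : μ ^ 2 - 1 / (β ^ 2 * z ^ 2) * ξ ^ 2
      = ξ ^ 2 * ((1 / ξ * μ) ^ 2 - 1 / (β ^ 2 * z ^ 2)) := by
    field_simp
  rw [h, Real.sqrt_mul (sq_nonneg ξ), Real.sqrt_sq h0.le]
  ring

theorem integral_mul_sqrt {κ μ : ℝ} (hκ : κ ≠ 0) :
    ∫ ξ in (0 : ℝ)..1, ξ * √(μ - κ * ξ ^ 2) = (√μ ^ 3 - √(μ - κ) ^ 3) / (3 * κ) := by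
  have h : ∀ ξ ∈ uIcc (0 : ℝ) 1,
      HasDerivAt (fun ξ : ℝ => -(√(μ - κ * ξ ^ 2) ^ 3 / (3 * κ))) (ξ * √(μ - κ * ξ ^ 2)) ξ := by
    intro ξ _
    have h1 : HasDerivAt (fun ξ : ℝ => μ - κ * ξ ^ 2) (-(κ * (2 * ξ))) ξ := by
      simpa using ((hasDerivAt_pow 2 ξ).const_mul κ).const_sub μ
    refine (((hasDerivAt_sqrt_pow_three _).comp ξ h1).div_const (3 * κ)).neg.congr_deriv ?_
    field_simp
  rw [intervalIntegral.integral_eq_sub_of_hasDerivAt h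
    (Continuous.intervalIntegrable (by fun_prop) _ _)]
  simp
  ring

theorem intervalIntegrable_nuIntegrand (β z : ℝ) :
    IntervalIntegrable (nuIntegrand nuInf β z) volume 0 1 := by
  have h : IntervalIntegrable
      (fun ξ : ℝ => ξ * √(nuInf (1 / (β * z)) ^ 2 - 1 / (β ^ 2 * z ^ 2) * ξ ^ 2)) volume 0 1 :=
    Continuous.intervalIntegrable (by fun_prop) _ _
  rw [intervalIntegrable_iff_integrableOn_Ioo_of_le zero_le_one] at h ⊢
  exact h.congr_fun (fun ξ hξ => (nuIntegrand_eq hξ).symm) measurableSet_Ioo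

theorem integral_nuIntegrand {β z : ℝ} (hβ : 0 < β) (hz : 0 < z) :
    ∫ ξ in (0 : ℝ)..1, nuIntegrand nuInf β z ξ =
      (nuInf (1 / (β * z)) ^ 3 - √(nuInf (1 / (β * z)) ^ 2 - 1 / (β ^ 2 * z ^ 2)) ^ 3) /
        (3 * (1 / (β ^ 2 * z ^ 2))) := by
  have hν : 0 ≤ nuInf (1 / (β * z)) := zero_le_one.trans (le_max_left _ _)
  rw [intervalIntegral.integral_of_le zero_le_one, integral_Ioc_eq_integral_Ioo,
    setIntegral_congr_fun measurableSet_Ioo (fun ξ hξ => nuIntegrand_eq hξ),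
    ← integral_Ioc_eq_integral_Ioo, ← intervalIntegral.integral_of_le zero_le_one,
    integral_mul_sqrt (by positivity), Real.sqrt_sq hν]

theorem gInf_eq_integral {β z : ℝ} (hβ : 0 < β) (hz : 0 < z) :
    gInf β z = 3 / (β ^ 2 * z ^ 2 * nuInf (1 / (β * z)) ^ 3) *
      ∫ ξ in (0 : ℝ)..1, nuIntegrand nuInf β z ξ := by
  rw [integral_nuIntegrand hβ hz, gInf_eq hβ hz]
  have hpos : 0 < β ^ 2 * z ^ 2 := by positivity
  have hκ : 1 / (β ^ 2 * z ^ 2) = (1 / (β * z)) ^ 2 := by field_simp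
  rcases le_total (1 / (β * z)) 1 with h | h
  · rw [show nuInf (1 / (β * z)) = 1 from max_eq_left h]
    field_simp
  · rw [show nuInf (1 / (β * z)) = 1 / (β * z) from max_eq_right h,
      Real.sqrt_eq_zero'.2 (by rw [hκ, sub_nonpos]; exact one_le_pow₀ h), hκ]
    simp
    field_simp

section Metric

/-! ### The maximum amoeba metric -/

theorem phi_nuInf (s t : ℝ) : phi nuInf s t = max |s| |t| := by
  unfold phi nuInf
  split_ifs with h
  · simp [h]
  · rw [mul_max_of_nonneg _ _ (abs_nonneg t), mul_one, ← abs_of_nonneg (abs_nonneg t), abs_abs,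
      ← abs_mul, mul_div_cancel₀ _ h, max_comm]

variable {β ρ : ℝ} {Ω : Set Plane} {u : Plane → ℝ} {x₀ p q h : Plane}

theorem curveLength_nuInf (hβ : 0 < β) (f : Plane → ℝ) (c : ℝ → Plane) :
    curveLength nuInf β f c = ∫⁻ t in Icc (0 : ℝ) 1, ENNReal.ofReal
      (max ‖derivWithin c (Icc 0 1) t‖ (β * |derivWithin (f ∘ c) (Icc 0 1) t|)) := by
  simp only [curveLength, phi_nuInf, abs_norm, abs_mul, abs_abs, abs_of_pos hβ]

theorem IsRegularCurve.contDiffOn_comp {c : ℝ → Plane} (hc : IsRegularCurve Ω p q c)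
    (hu : ContDiffOn ℝ ∞ u Ω) : ContDiffOn ℝ 1 (u ∘ c) (Icc 0 1) :=
  (hu.of_le (by exact_mod_cast le_top)).comp hc.contDiffOn hc.mapsTo

theorem ofReal_norm_sub_le_amoebaDist (hβ : 0 < β) :
    ENNReal.ofReal ‖q - p‖ ≤ amoebaDist nuInf β Ω u p q := by
  refine le_iInf₂ fun c hc => ?_
  rw [curveLength_nuInf hβ, ofReal_norm, ← hc.source, ← hc.target]
  refine (enorm_sub_le_lintegral_derivWithin_Icc_of_contDiffOn_Icc hc.contDiffOn
    zero_le_one).trans (lintegral_mono fun t => ?_)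
  rw [← ofReal_norm]
  exact ENNReal.ofReal_le_ofReal (le_max_left _ _)

theorem ofReal_abs_sub_le_amoebaDist (hβ : 0 < β) (hu : ContDiffOn ℝ ∞ u Ω) :
    ENNReal.ofReal (β * |u q - u p|) ≤ amoebaDist nuInf β Ω u p q := by
  refine le_iInf₂ fun c hc => ?_
  rw [curveLength_nuInf hβ, ENNReal.ofReal_mul hβ.le, ← hc.source, ← hc.target,
    ← Real.norm_eq_abs, ofReal_norm]
  have h := enorm_sub_le_lintegral_derivWithin_Icc_of_contDiffOn_Icc (hc.contDiffOn_comp hu)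
    zero_le_one
  calc ENNReal.ofReal β * ‖u (c 1) - u (c 0)‖ₑ
      ≤ ENNReal.ofReal β * ∫⁻ t in Icc (0 : ℝ) 1, ‖derivWithin (u ∘ c) (Icc 0 1) t‖ₑ := by
        gcongr
        exact h
    _ = ∫⁻ t in Icc (0 : ℝ) 1, ENNReal.ofReal β * ‖derivWithin (u ∘ c) (Icc 0 1) t‖ₑ :=
        (lintegral_const_mul' _ _ ENNReal.ofReal_ne_top).symm
    _ ≤ _ := lintegral_mono fun t => by
        rw [← ofReal_norm, ← ENNReal.ofReal_mul hβ.le]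
        exact ENNReal.ofReal_le_ofReal (le_max_right _ _)

/-- Each of the two terms in the maximum bounds the length from below separately. -/
theorem amoeba_subset (hβ : 0 < β) (hρ : 0 ≤ ρ) (hu : ContDiffOn ℝ ∞ u Ω) :
    amoeba nuInf β Ω u ρ x₀ ⊆ {q | ‖q - x₀‖ ≤ ρ ∧ β * |u q - u x₀| ≤ ρ} := fun _ hq =>
  ⟨(ENNReal.ofReal_le_ofReal_iff hρ).1 ((ofReal_norm_sub_le_amoebaDist hβ).trans hq.2),
    (ENNReal.ofReal_le_ofReal_iff hρ).1 ((ofReal_abs_sub_le_amoebaDist hβ hu).trans hq.2)⟩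

/-- Only `|(u ∘ c)'|` enters the length. This lets lower bounds for medians follow from upper bounds
applied to `-u`. -/
theorem amoeba_neg : amoeba nuInf β Ω (-u) ρ x₀ = amoeba nuInf β Ω u ρ x₀ := by
  have h : ∀ c : ℝ → Plane, curveLength nuInf β (-u) c = curveLength nuInf β u c := by
    intro c
    unfold curveLength
    refine lintegral_congr fun t => ?_
    rw [show (-u) ∘ c = -(u ∘ c) from rfl, derivWithin.neg, abs_neg]
  simp only [amoeba, amoebaDist, h]

/-! ### Straight line segments -/

theorem hasDerivWithinAt_segment (t : ℝ) (s : Set ℝ) :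
    HasDerivWithinAt (fun t : ℝ => x₀ + t • h) h s t := by
  simpa using (((hasDerivAt_id t).smul_const h).const_add x₀).hasDerivWithinAt

theorem derivWithin_segment {t : ℝ} (ht : t ∈ Icc (0 : ℝ) 1) :
    derivWithin (fun t : ℝ => x₀ + t • h) (Icc 0 1) t = h :=
  (hasDerivWithinAt_segment t _).derivWithin (uniqueDiffOn_Icc_zero_one t ht)

theorem isRegularCurve_segment (hh : h ≠ 0) (hΩ : ∀ t ∈ Icc (0 : ℝ) 1, x₀ + t • h ∈ Ω) :
    IsRegularCurve Ω x₀ (x₀ + h) (fun t : ℝ => x₀ + t • h) where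
  contDiffOn := by fun_prop
  deriv_ne_zero t ht := by rwa [derivWithin_segment ht]
  mapsTo := hΩ
  source := by simp
  target := by simp

theorem hasDerivWithinAt_comp_segment {t : ℝ} (hd : DifferentiableAt ℝ u (x₀ + t • h))
    (s : Set ℝ) :
    HasDerivWithinAt (u ∘ fun t : ℝ => x₀ + t • h) (fderiv ℝ u (x₀ + t • h) h) s t :=
  hd.hasFDerivAt.comp_hasDerivWithinAt t (hasDerivWithinAt_segment t s)

theorem derivWithin_comp_segment {t : ℝ} (ht : t ∈ Icc (0 : ℝ) 1)
    (hd : DifferentiableAt ℝ u (x₀ + t • h)) :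
    derivWithin (u ∘ fun t : ℝ => x₀ + t • h) (Icc 0 1) t = fderiv ℝ u (x₀ + t • h) h :=
  (hasDerivWithinAt_comp_segment hd _).derivWithin (uniqueDiffOn_Icc_zero_one t ht)

theorem amoebaDist_le_segment (hβ : 0 < β) (hh : h ≠ 0)
    (hΩ : ∀ t ∈ Icc (0 : ℝ) 1, x₀ + t • h ∈ Ω)
    (hd : ∀ t ∈ Icc (0 : ℝ) 1, DifferentiableAt ℝ u (x₀ + t • h)) :
    amoebaDist nuInf β Ω u x₀ (x₀ + h) ≤ ∫⁻ t in Icc (0 : ℝ) 1, ENNReal.ofReal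
      (max ‖h‖ (β * |fderiv ℝ u (x₀ + t • h) h|)) := by
  refine (iInf₂_le _ (isRegularCurve_segment hh hΩ)).trans_eq ?_
  rw [curveLength_nuInf hβ]
  refine setLIntegral_congr_fun measurableSet_Icc fun t ht => ?_
  simp only [derivWithin_segment ht, derivWithin_comp_segment ht (hd t ht)]

theorem mem_amoeba_of_max_le (hβ : 0 < β) (hh : h ≠ 0)
    (hΩ : ∀ t ∈ Icc (0 : ℝ) 1, x₀ + t • h ∈ Ω)
    (hd : ∀ t ∈ Icc (0 : ℝ) 1, DifferentiableAt ℝ u (x₀ + t • h))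
    (hle : ∀ t ∈ Icc (0 : ℝ) 1, max ‖h‖ (β * |fderiv ℝ u (x₀ + t • h) h|) ≤ ρ) :
    x₀ + h ∈ amoeba nuInf β Ω u ρ x₀ := by
  refine ⟨by simpa using hΩ 1 (by simp), (amoebaDist_le_segment hβ hh hΩ hd).trans ?_⟩
  refine (setLIntegral_mono measurable_const
    fun t ht => ENNReal.ofReal_le_ofReal (hle t ht)).trans_eq ?_
  simp

/-- Where the contrast term dominates with constant sign `σ`, the length integrand is `β σ (u ∘
c)'`, and the fundamental theorem of calculus gives the length in terms of the endpoints alone. -/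
theorem mem_amoeba_of_norm_le (hβ : 0 < β) (hu : ContDiffOn ℝ ∞ u Ω) (hh : h ≠ 0)
    (hΩ : ∀ t ∈ Icc (0 : ℝ) 1, x₀ + t • h ∈ Ω)
    (hd : ∀ t ∈ Icc (0 : ℝ) 1, DifferentiableAt ℝ u (x₀ + t • h)) {σ : ℝ} (hσ : |σ| = 1)
    (hle : ∀ t ∈ Icc (0 : ℝ) 1, ‖h‖ ≤ β * (σ * fderiv ℝ u (x₀ + t • h) h))
    (hq : β * |u (x₀ + h) - u x₀| ≤ ρ) :
    x₀ + h ∈ amoeba nuInf β Ω u ρ x₀ := by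
  refine ⟨by simpa using hΩ 1 (by simp), (amoebaDist_le_segment hβ hh hΩ hd).trans ?_⟩
  have hC := (isRegularCurve_segment hh hΩ).contDiffOn_comp hu
  set D := derivWithin (u ∘ fun t : ℝ => x₀ + t • h) (Icc 0 1)
  have hD : ∀ t ∈ Icc (0 : ℝ) 1, D t = fderiv ℝ u (x₀ + t • h) h :=
    fun t ht => derivWithin_comp_segment ht (hd t ht)
  have hDc : ContinuousOn D (Icc 0 1) :=
    hC.continuousOn_derivWithin uniqueDiffOn_Icc_zero_one le_rfl
  have hint : IntegrableOn (fun t => β * (σ * D t)) (Icc 0 1) :=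
    (continuousOn_const.mul (continuousOn_const.mul hDc)).integrableOn_compact isCompact_Icc
  have hpos : ∀ t ∈ Icc (0 : ℝ) 1, 0 ≤ σ * D t := fun t ht => by
    have := (norm_nonneg h).trans (hle t ht)
    rw [hD t ht]
    exact nonneg_of_mul_nonneg_right this hβ
  have habs : ∀ t ∈ Icc (0 : ℝ) 1, |D t| = σ * D t := fun t ht => by
    rw [← abs_of_nonneg (hpos t ht), abs_mul, hσ, one_mul]
  calc ∫⁻ t in Icc (0 : ℝ) 1, ENNReal.ofReal (max ‖h‖ (β * |fderiv ℝ u (x₀ + t • h) h|))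
      = ∫⁻ t in Icc (0 : ℝ) 1, ENNReal.ofReal (β * (σ * D t)) := by
        refine setLIntegral_congr_fun measurableSet_Icc fun t ht => ?_
        rw [← hD t ht, habs t ht, max_eq_right]
        rw [hD t ht]
        exact hle t ht
    _ = ENNReal.ofReal (∫ t in Icc (0 : ℝ) 1, β * (σ * D t)) := by
        rw [ofReal_integral_eq_lintegral_ofReal hint]
        filter_upwards [self_mem_ae_restrict measurableSet_Icc] with t ht
        exact mul_nonneg hβ.le (hpos t ht)
    _ ≤ ENNReal.ofReal ρ := by
        refine ENNReal.ofReal_le_ofReal ?_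
        have hFTC := intervalIntegral.integral_derivWithin_Icc_of_contDiffOn_Icc hC zero_le_one
        rw [integral_const_mul, integral_const_mul, integral_Icc_eq_integral_Ioc,
          ← intervalIntegral.integral_of_le zero_le_one, hFTC]
        simp only [Function.comp, one_smul, zero_smul, add_zero]
        refine le_trans ?_ hq
        gcongr
        refine (le_abs_self _).trans ?_
        rw [abs_mul, hσ, one_mul]

end Metric

section DiskSlices

/-! ### Areas cut from the unit disk by perturbed lines -/

/-- A binary quadratic form. -/
def quad (A B C x y : ℝ) : ℝ := A * x ^ 2 + B * x * y + C * y ^ 2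

/-- The horizontal slice at height `y` of the part of the unit disk where `x + ρ q(x, y) ≤ τ`,
with `q` a quadratic form. -/
def diskSlice (A B C ρ τ y : ℝ) : Set ℝ := {x | x ^ 2 + y ^ 2 ≤ 1 ∧ x + ρ * quad A B C x y ≤ τ}

/-- The part of the unit disk where `x + ρ q(x, y) ≤ τ`, with `q` a quadratic form. -/
def diskPart (A B C ρ τ : ℝ) : Set (ℝ × ℝ) :=
  {v | v.1 ^ 2 + v.2 ^ 2 ≤ 1 ∧ v.1 + ρ * quad A B C v.1 v.2 ≤ τ}

variable {A B C ρ τ k η x y : ℝ}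

theorem abs_quad_le (h : x ^ 2 + y ^ 2 ≤ 1) : |quad A B C x y| ≤ |A| + |B| + |C| := by
  have hx : x ^ 2 ≤ 1 := by nlinarith [sq_nonneg y]
  have hy : y ^ 2 ≤ 1 := by nlinarith [sq_nonneg x]
  have hx1 : |x| ≤ 1 := (sq_le_one_iff_abs_le_one x).1 hx
  have hy1 : |y| ≤ 1 := (sq_le_one_iff_abs_le_one y).1 hy
  refine (abs_add_three _ _ _).trans ?_
  simp only [abs_mul, abs_pow, sq_abs]
  have h1 : |A| * x ^ 2 ≤ |A| := mul_le_of_le_one_right (abs_nonneg A) hx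
  have h2 : |B| * |x| * |y| ≤ |B| :=
    (mul_le_of_le_one_right (by positivity) hy1).trans (mul_le_of_le_one_right (abs_nonneg B) hx1)
  have h3 : |C| * y ^ 2 ≤ |C| := mul_le_of_le_one_right (abs_nonneg C) hy
  linarith

theorem abs_quad_sub_quad_le (hx : |x| ≤ 1) (hk : |k| ≤ 1) (hy : |y| ≤ 1) :
    |quad A B C x y - quad A B C k y| ≤ |x - k| * (2 * |A| + |B|) := by
  have h : quad A B C x y - quad A B C k y = (x - k) * (A * (x + k) + B * y) := by
    unfold quad
    ring
  rw [h, abs_mul]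
  gcongr
  refine (abs_add_le _ _).trans ?_
  rw [abs_mul, abs_mul]
  have h1 : |x + k| ≤ 2 := (abs_add_le _ _).trans (by linarith)
  have h2 : |A| * |x + k| ≤ |A| * 2 := by gcongr
  have h3 : |B| * |y| ≤ |B| := mul_le_of_le_one_right (abs_nonneg B) hy
  linarith

theorem diskSlice_subset : diskSlice A B C ρ τ y ⊆ Icc (-1) 1 := fun x hx =>
  abs_le.1 ((sq_le_one_iff_abs_le_one x).1 (by nlinarith [hx.1, sq_nonneg y]))

theorem diskSlice_eq_empty (hy : 1 < y ^ 2) : diskSlice A B C ρ τ y = ∅ := by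
  refine eq_empty_of_forall_notMem fun x hx => ?_
  nlinarith [hx.1, sq_nonneg x]

/-- A point farther from the line `x = k` than the size of the perturbation stays on its side. The
factor `0 *` matches membership in the unperturbed slice. -/
theorem add_mul_quad_le_iff (h : x ^ 2 + y ^ 2 ≤ 1) (hρ : 0 ≤ ρ)
    (hk : ρ * (|A| + |B| + |C| + |η|) < |x - k|) :
    x + ρ * quad A B C x y ≤ k + ρ * η ↔ x + 0 * quad A B C x y ≤ k := by
  have h1 : |ρ * (quad A B C x y - η)| < |x - k| := by
    refine lt_of_le_of_lt ?_ hk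
    rw [abs_mul, abs_of_nonneg hρ]
    gcongr
    exact (abs_sub _ _).trans (by linarith [abs_quad_le (A := A) (B := B) (C := C) h])
  have h2 := abs_lt.1 h1
  rcases le_total x k with hx | hx
  · rw [abs_of_nonpos (by linarith)] at h2
    exact ⟨fun _ => by linarith, fun _ => by linarith⟩
  · rw [abs_of_nonneg (by linarith)] at h2
    exact ⟨fun _ => by linarith, fun _ => by linarith⟩

theorem volume_real_diskSlice_ne_top : volume (diskSlice A B C ρ τ y) ≠ ⊤ :=
  ((measure_mono diskSlice_subset).trans_lt measure_Icc_lt_top).ne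

theorem abs_volume_diskSlice_sub_le (hρ : 0 ≤ ρ) :
    |volume.real (diskSlice A B C ρ (k + ρ * η) y) - volume.real (diskSlice A B C 0 k y)| ≤
      2 * (ρ * (|A| + |B| + |C| + |η|)) := by
  set δ := ρ * (|A| + |B| + |C| + |η|)
  have hδ : 0 ≤ δ := by positivity
  have key : ∀ {S T : Set ℝ}, volume T ≠ ⊤ → (∀ x ∈ S, δ < |x - k| → x ∈ T) →
      volume.real S ≤ volume.real T + 2 * δ := by
    intro S T hT h
    have hsub : S ⊆ T ∪ Icc (k - δ) (k + δ) := by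
      intro x hx
      by_cases hxk : δ < |x - k|
      · exact Or.inl (h x hx hxk)
      · have := abs_le.1 (not_lt.1 hxk)
        exact Or.inr ⟨by linarith, by linarith⟩
    refine (measureReal_mono hsub (measure_union_lt_top hT.lt_top measure_Icc_lt_top).ne).trans ?_
    refine (measureReal_union_le _ _).trans ?_
    rw [Real.volume_real_Icc_of_le (by linarith)]
    linarith
  rw [abs_sub_le_iff]
  constructor
  · linarith [key (S := diskSlice A B C ρ (k + ρ * η) y) volume_real_diskSlice_ne_top
      fun x hx h => (⟨hx.1, (add_mul_quad_le_iff hx.1 hρ h).1 hx.2⟩ : x ∈ diskSlice A B C 0 k y)]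
  · linarith [key (S := diskSlice A B C 0 k y) volume_real_diskSlice_ne_top
      fun x hx h => (⟨hx.1, (add_mul_quad_le_iff hx.1 hρ h).2 hx.2⟩ :
        x ∈ diskSlice A B C ρ (k + ρ * η) y)]

/-- At such heights the line `x = k` has positive distance from the disk slice, so a small
perturbation does not reach it. -/
theorem diskSlice_eventuallyEq (A B C η : ℝ) (h : 1 - k ^ 2 < y ^ 2) :
    ∀ᶠ ρ : ℝ in 𝓝[>] 0, diskSlice A B C ρ (k + ρ * η) y = diskSlice A B C 0 k y := by
  rcases lt_or_ge 1 (y ^ 2) with hy | hy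
  · exact Eventually.of_forall fun ρ => by simp only [diskSlice_eq_empty hy]
  have hgap : 0 < |k| - √(1 - y ^ 2) := by
    rw [sub_pos, Real.sqrt_lt' (abs_pos.2 _), sq_abs]
    · linarith
    · rintro rfl
      linarith
  have hlim : Tendsto (fun ρ : ℝ => ρ * (|A| + |B| + |C| + |η|)) (𝓝[>] 0) (𝓝 0) := by
    have : Continuous fun ρ : ℝ => ρ * (|A| + |B| + |C| + |η|) := by fun_prop
    simpa using (this.tendsto 0).mono_left nhdsWithin_le_nhds
  filter_upwards [hlim.eventually (gt_mem_nhds hgap), self_mem_nhdsWithin] with ρ h1 h0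
  ext x
  refine and_congr_right fun hx => add_mul_quad_le_iff hx (le_of_lt h0) (h1.trans_le ?_)
  have hx' : |x| ≤ √(1 - y ^ 2) := Real.abs_le_sqrt (by linarith)
  linarith [abs_sub_abs_le_abs_sub k x, abs_sub_comm k x]

/-- Near the cut, `quad` may be frozen at `(k, y)`: the cut moves only by `O(ρ)` and `quad` is
Lipschitz in `x`, so the error is `O(ρ²)`. The slice is thus trapped between the intervals from `-b`
to `e - ρ δ` and to `e + ρ δ`. -/
theorem volume_diskSlice_sub_div_le (hky : k ^ 2 + y ^ 2 ≤ 1) (hρ : 0 < ρ) :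
    let b := √(1 - y ^ 2)
    let δ := ρ * ((|A| + |B| + |C| + |η|) * (2 * |A| + |B|))
    let e := k + ρ * (η - quad A B C k y)
    e + ρ * δ ≤ b → -b ≤ e - ρ * δ →
    |(volume.real (diskSlice A B C ρ (k + ρ * η) y) - volume.real (diskSlice A B C 0 k y)) / ρ -
      (η - quad A B C k y)| ≤ δ := by
  intro b δ e hb hb'
  have hk2 : k ^ 2 ≤ 1 := by nlinarith [sq_nonneg y]
  have hy2 : y ^ 2 ≤ 1 := by nlinarith [sq_nonneg k]
  have hk1 : |k| ≤ 1 := (sq_le_one_iff_abs_le_one k).1 hk2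
  have hy1 : |y| ≤ 1 := (sq_le_one_iff_abs_le_one y).1 hy2
  have hkb : |k| ≤ b := Real.abs_le_sqrt (by linarith)
  have hδ : 0 ≤ δ := by positivity
  have hρδ : 0 ≤ ρ * δ := by positivity
  have hdisk : ∀ x : ℝ, x ^ 2 + y ^ 2 ≤ 1 ↔ x ∈ Icc (-b) b := fun x => by
    rw [mem_Icc, ← abs_le, Real.le_sqrt (abs_nonneg x) (by linarith), sq_abs]
    exact ⟨fun h => by linarith, fun h => by linarith⟩
  have hq := abs_quad_le (A := A) (B := B) (C := C) hky
  have hqη : |ρ * (η - quad A B C k y)| ≤ ρ * (|A| + |B| + |C| + |η|) := by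
    rw [abs_mul, abs_of_pos hρ]
    gcongr
    exact (abs_sub _ _).trans (by linarith)
  have hnear : ∀ x, x ^ 2 + y ^ 2 ≤ 1 → |x - k| ≤ ρ * (|A| + |B| + |C| + |η|) →
      |ρ * quad A B C x y - ρ * quad A B C k y| ≤ ρ * δ := by
    intro x hx hxk
    have hx1 : |x| ≤ 1 := (sq_le_one_iff_abs_le_one x).1 (by nlinarith [sq_nonneg y])
    rw [← mul_sub, abs_mul, abs_of_pos hρ]
    gcongr
    refine (abs_quad_sub_quad_le hx1 hk1 hy1).trans ?_
    calc |x - k| * (2 * |A| + |B|) ≤ ρ * (|A| + |B| + |C| + |η|) * (2 * |A| + |B|) := by gcongr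
      _ = δ := by ring
  have hbase : volume.real (diskSlice A B C 0 k y) = k + b := by
    have : diskSlice A B C 0 k y = Icc (-b) k := by
      ext x
      simp only [diskSlice, mem_ofPred_eq, hdisk, mem_Icc, zero_mul, add_zero]
      exact ⟨fun h => ⟨h.1.1, h.2⟩, fun h => ⟨⟨h.1, h.2.trans ((le_abs_self k).trans hkb)⟩, h.2⟩⟩
    rw [this, Real.volume_real_Icc_of_le (by linarith [neg_abs_le k])]
    ring
  have hup : volume.real (diskSlice A B C ρ (k + ρ * η) y) ≤ e + ρ * δ + b := by
    have hsub : diskSlice A B C ρ (k + ρ * η) y ⊆ Icc (-b) (e + ρ * δ) := by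
      intro x hx
      refine ⟨((hdisk x).1 hx.1).1, ?_⟩
      by_cases hxk : |x - k| ≤ ρ * (|A| + |B| + |C| + |η|)
      · have h1 := abs_le.1 (hnear x hx.1 hxk)
        have h2 := hx.2
        simp only [e]
        linarith
      · have h1 := (add_mul_quad_le_iff hx.1 hρ.le (not_le.1 hxk)).1 hx.2
        rw [not_le, abs_of_nonpos (show x - k ≤ 0 by linarith)] at hxk
        simp only [e]
        linarith [(abs_le.1 hqη).1]
    refine (measureReal_mono hsub measure_Icc_lt_top.ne).trans ?_
    rw [Real.volume_real_Icc_of_le (by linarith)]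
    linarith
  have hlow : e - ρ * δ + b ≤ volume.real (diskSlice A B C ρ (k + ρ * η) y) := by
    have hsub : Icc (-b) (e - ρ * δ) ⊆ diskSlice A B C ρ (k + ρ * η) y := by
      intro x hx
      have hxd : x ^ 2 + y ^ 2 ≤ 1 := (hdisk x).2 ⟨hx.1, by linarith [hx.2]⟩
      refine ⟨hxd, ?_⟩
      have h2 := hx.2
      simp only [e] at h2
      by_cases hxk : |x - k| ≤ ρ * (|A| + |B| + |C| + |η|)
      · have h1 := abs_le.1 (hnear x hxd hxk)
        linarith
      · refine (add_mul_quad_le_iff hxd hρ.le (not_le.1 hxk)).2 ?_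
        rw [zero_mul, add_zero]
        by_contra hlt
        rw [not_le, abs_of_nonneg (show 0 ≤ x - k by linarith)] at hxk
        linarith [(abs_le.1 hqη).2]
    refine le_trans ?_ (measureReal_mono hsub volume_real_diskSlice_ne_top)
    rw [Real.volume_real_Icc_of_le (by linarith)]
    linarith
  have hsplit : (volume.real (diskSlice A B C ρ (k + ρ * η) y) -
      volume.real (diskSlice A B C 0 k y)) / ρ - (η - quad A B C k y) =
      (volume.real (diskSlice A B C ρ (k + ρ * η) y) - (e + b)) / ρ := by
    rw [hbase]
    simp only [e]
    field_simp
    ring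
  rw [hsplit, abs_div, abs_of_pos hρ, div_le_iff₀ hρ, abs_le]
  constructor <;> linarith

theorem tendsto_volume_diskSlice (A B C η : ℝ) (h : y ^ 2 < 1 - k ^ 2) :
    Tendsto (fun ρ : ℝ => (volume.real (diskSlice A B C ρ (k + ρ * η) y) -
      volume.real (diskSlice A B C 0 k y)) / ρ) (𝓝[>] 0) (𝓝 (η - quad A B C k y)) := by
  set b := √(1 - y ^ 2)
  have hkb : |k| < b := by
    rw [Real.lt_sqrt (abs_nonneg k), sq_abs]
    linarith
  have hlim : ∀ f : ℝ → ℝ, Continuous f → Tendsto f (𝓝[>] 0) (𝓝 (f 0)) := fun f hf =>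
    (hf.tendsto 0).mono_left nhdsWithin_le_nhds
  have h1 := hlim (fun ρ => k + ρ * (η - quad A B C k y) +
    ρ * (ρ * ((|A| + |B| + |C| + |η|) * (2 * |A| + |B|)))) (by fun_prop)
  have h2 := hlim (fun ρ => k + ρ * (η - quad A B C k y) -
    ρ * (ρ * ((|A| + |B| + |C| + |η|) * (2 * |A| + |B|)))) (by fun_prop)
  have h3 := hlim (fun ρ => ρ * ((|A| + |B| + |C| + |η|) * (2 * |A| + |B|))) (by fun_prop)
  simp only [zero_mul, add_zero, sub_zero] at h1 h2 h3
  rw [tendsto_iff_norm_sub_tendsto_zero]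
  refine squeeze_zero' (Eventually.of_forall fun _ => norm_nonneg _) ?_ h3
  filter_upwards [h1.eventually (gt_mem_nhds ((le_abs_self k).trans_lt hkb)),
    h2.eventually (lt_mem_nhds (show -b < k by linarith [neg_abs_le k])), self_mem_nhdsWithin]
    with ρ hρ1 hρ2 hρ
  exact volume_diskSlice_sub_div_le (by linarith) hρ hρ1.le hρ2.le

theorem continuous_quad : Continuous fun v : ℝ × ℝ => quad A B C v.1 v.2 := by
  unfold quad
  fun_prop

theorem measurableSet_diskPart : MeasurableSet (diskPart A B C ρ τ) := by
  have h := (continuous_quad (A := A) (B := B) (C := C)).measurable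
  have h1 : Measurable fun v : ℝ × ℝ => v.1 ^ 2 + v.2 ^ 2 := by fun_prop
  have h2 : Measurable fun v : ℝ × ℝ => v.1 + ρ * quad A B C v.1 v.2 := by fun_prop
  exact (measurableSet_le h1 measurable_const).inter (measurableSet_le h2 measurable_const)

theorem integrable_volume_diskSlice (A B C ρ τ : ℝ) :
    Integrable fun y => volume.real (diskSlice A B C ρ τ y) := by
  have hm : Measurable fun y => volume.real (diskSlice A B C ρ τ y) :=
    (measurable_measure_prodMk_right measurableSet_diskPart).ennreal_toReal
  have hg : Integrable ((Icc (-1 : ℝ) 1).indicator fun _ => (2 : ℝ)) :=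
    (integrable_indicator_iff measurableSet_Icc).2 (integrableOn_const measure_Icc_lt_top.ne)
  refine hg.mono' hm.aestronglyMeasurable (Eventually.of_forall fun y => ?_)
  by_cases hy : y ∈ Icc (-1 : ℝ) 1
  · rw [indicator_of_mem hy, Real.norm_of_nonneg measureReal_nonneg]
    refine (measureReal_mono diskSlice_subset measure_Icc_lt_top.ne).trans ?_
    rw [Real.volume_real_Icc_of_le (by norm_num)]
    norm_num
  · rw [indicator_of_notMem hy, diskSlice_eq_empty]
    · simp
    · rw [one_lt_sq_iff_one_lt_abs]
      by_contra h
      exact hy (abs_le.1 (not_lt.1 h))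

theorem volume_diskPart : volume.real (diskPart A B C ρ τ) =
    ∫ y, volume.real (diskSlice A B C ρ τ y) := by
  have hm := measurable_measure_prodMk_right (μ := (volume : Measure ℝ))
    (measurableSet_diskPart (A := A) (B := B) (C := C) (ρ := ρ) (τ := τ))
  rw [measureReal_def, Measure.volume_eq_prod, Measure.prod_apply_symm measurableSet_diskPart]
  exact (integral_toReal hm.aemeasurable
    (Eventually.of_forall fun y => volume_real_diskSlice_ne_top.lt_top)).symm

/-- First order change of the area of a circular segment under a quadratic perturbation of the
line that cuts it off. -/
theorem tendsto_volume_diskPart (A B C k η : ℝ) :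
    Tendsto (fun ρ : ℝ => (volume.real (diskPart A B C ρ (k + ρ * η)) -
      volume.real (diskPart A B C 0 k)) / ρ) (𝓝[>] 0)
      (𝓝 (∫ y in (-√(1 - k ^ 2))..√(1 - k ^ 2), (η - quad A B C k y))) := by
  set Y := √(1 - k ^ 2)
  have hlim : ∫ y in (-Y)..Y, (η - quad A B C k y) =
      ∫ y, (Ioo (-Y) Y).indicator (fun y => η - quad A B C k y) y := by
    rw [intervalIntegral.integral_of_le (by linarith [Real.sqrt_nonneg (1 - k ^ 2)]),
      integral_Ioc_eq_integral_Ioo, integral_indicator measurableSet_Ioo]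
  have hfun : ∀ ρ, (volume.real (diskPart A B C ρ (k + ρ * η)) -
      volume.real (diskPart A B C 0 k)) / ρ =
      ∫ y, (volume.real (diskSlice A B C ρ (k + ρ * η) y) -
        volume.real (diskSlice A B C 0 k y)) / ρ := fun ρ => by
    rw [volume_diskPart, volume_diskPart, integral_div, integral_sub]
    · exact integrable_volume_diskSlice _ _ _ _ _
    · exact integrable_volume_diskSlice _ _ _ _ _
  simp only [hlim, hfun]
  -- Slice quotients converge at every height except `± Y`, where the line meets the circle, and
  -- `abs_volume_diskSlice_sub_le` bounds them uniformly in `ρ`.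
  refine tendsto_integral_filter_of_dominated_convergence
    ((Icc (-1 : ℝ) 1).indicator fun _ => 2 * (|A| + |B| + |C| + |η|)) ?_ ?_ ?_ ?_
  · refine Eventually.of_forall fun ρ => ?_
    exact (((integrable_volume_diskSlice A B C ρ _).sub
      (integrable_volume_diskSlice A B C 0 k)).div_const ρ).aestronglyMeasurable
  · filter_upwards [self_mem_nhdsWithin] with ρ hρ
    have hρ : 0 < ρ := hρ
    refine Eventually.of_forall fun y => ?_
    by_cases hy : y ∈ Icc (-1 : ℝ) 1
    · rw [indicator_of_mem hy, norm_div, Real.norm_of_nonneg hρ.le, div_le_iff₀ hρ]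
      refine (abs_volume_diskSlice_sub_le hρ.le).trans_eq (by ring)
    · have hy' : 1 < y ^ 2 := by
        rw [one_lt_sq_iff_one_lt_abs]
        by_contra h
        exact hy (abs_le.1 (not_lt.1 h))
      simp [indicator_of_notMem hy, diskSlice_eq_empty hy']
  · exact (integrable_indicator_iff measurableSet_Icc).2 (integrableOn_const measure_Icc_lt_top.ne)
  · have hY : ∀ᵐ y : ℝ, y ≠ Y ∧ y ≠ -Y := by
      rw [eventually_and]
      exact ⟨Measure.ae_ne volume Y, Measure.ae_ne volume (-Y)⟩
    filter_upwards [hY] with y hy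
    by_cases hmem : y ∈ Ioo (-Y) Y
    · rw [indicator_of_mem hmem]
      refine tendsto_volume_diskSlice A B C η ?_
      have := (Real.lt_sqrt (abs_nonneg y)).1 (abs_lt.2 hmem)
      rwa [sq_abs] at this
    · rw [indicator_of_notMem hmem]
      have h1 : Y < |y| := by
        refine lt_of_le_of_ne (not_lt.1 fun h => hmem (abs_lt.1 h)) fun h => ?_
        rcases eq_or_eq_neg_of_abs_eq h.symm with h | h
        exacts [hy.1 h, hy.2 h]
      have h2 : 1 - k ^ 2 < y ^ 2 := by
        have h3 : 0 < |y| := (Real.sqrt_nonneg _).trans_lt h1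
        rw [← sq_abs y]
        exact (Real.sqrt_lt' h3).1 h1
      refine tendsto_const_nhds.congr' ?_
      filter_upwards [diskSlice_eventuallyEq A B C η h2] with ρ hρ
      rw [hρ, sub_self, zero_div]

end DiskSlices

/-! ### First order balance of areas in the disk cut by a strip -/

section DiskParts

variable {A B C ρ τ k η x y κ σ K L m t : ℝ}

theorem isBounded_unitDisk : Bornology.IsBounded {v : ℝ × ℝ | v.1 ^ 2 + v.2 ^ 2 ≤ 1} := by
  refine (Metric.isBounded_closedBall (x := (0 : ℝ × ℝ)) (r := 1)).subset fun v hv => ?_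
  have hv : v.1 ^ 2 + v.2 ^ 2 ≤ 1 := hv
  rw [mem_closedBall_zero_iff, Prod.norm_def, max_le_iff, Real.norm_eq_abs, Real.norm_eq_abs,
    ← sq_le_one_iff_abs_le_one, ← sq_le_one_iff_abs_le_one]
  constructor <;> nlinarith [sq_nonneg v.1, sq_nonneg v.2]

theorem volume_ne_top_of_subset_unitDisk {S : Set (ℝ × ℝ)}
    (h : S ⊆ {v : ℝ × ℝ | v.1 ^ 2 + v.2 ^ 2 ≤ 1}) : volume S ≠ ⊤ :=
  (isBounded_unitDisk.subset h).measure_lt_top.ne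

theorem diskPart_subset : diskPart A B C ρ τ ⊆ {v : ℝ × ℝ | v.1 ^ 2 + v.2 ^ 2 ≤ 1} :=
  fun _ hv => hv.1

theorem volume_vertical_line (k : ℝ) : volume {v : ℝ × ℝ | v.1 = k} = 0 := by
  have h : {v : ℝ × ℝ | v.1 = k} = {k} ×ˢ univ := by
    ext v
    simp
  rw [h, Measure.volume_eq_prod, Measure.prod_prod]
  simp

/-- Opposite circular segments have the same area. -/
theorem volume_diskPart_zero_add (A B C k : ℝ) :
    volume.real (diskPart A B C 0 k) + volume.real (diskPart A B C 0 (-k)) =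
      volume.real {v : ℝ × ℝ | v.1 ^ 2 + v.2 ^ 2 ≤ 1} := by
  have hneg : volume.real (diskPart A B C 0 (-k)) =
      volume.real {v : ℝ × ℝ | v.1 ^ 2 + v.2 ^ 2 ≤ 1 ∧ k ≤ v.1} := by
    rw [measureReal_def, measureReal_def, ← Measure.measure_neg volume (diskPart A B C 0 (-k))]
    congr 2
    ext v
    simp only [diskPart, Set.mem_neg, mem_ofPred_eq, Prod.fst_neg, Prod.snd_neg, neg_sq, zero_mul,
      add_zero, neg_le_neg_iff]
  rw [hneg, ← measureReal_union_add_inter' measurableSet_diskPart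
    (volume_ne_top_of_subset_unitDisk diskPart_subset)
    (volume_ne_top_of_subset_unitDisk fun v hv => hv.1)]
  have hnull : volume.real (diskPart A B C 0 k ∩
      {v : ℝ × ℝ | v.1 ^ 2 + v.2 ^ 2 ≤ 1 ∧ k ≤ v.1}) = 0 := by
    rw [measureReal_def, measure_mono_null _ (volume_vertical_line k), ENNReal.toReal_zero]
    rintro v ⟨h1, h2⟩
    have h3 := h1.2
    rw [zero_mul, add_zero] at h3
    exact le_antisymm h3 h2.2
  rw [hnull, add_zero]
  congr 1
  ext v
  simp only [diskPart, mem_union, mem_ofPred_eq, zero_mul, add_zero, ← and_or_left]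
  exact and_iff_left (le_total _ _)

/-- The mixed term `B k y` is odd in `y` and drops out. -/
theorem integral_sub_quad (A B C k η Y : ℝ) :
    ∫ y in (-Y)..Y, (η - quad A B C k y) = 2 * Y * η - 2 * Y * (A * k ^ 2) - 2 / 3 * C * Y ^ 3 := by
  have h : ∀ y ∈ uIcc (-Y) Y, HasDerivAt
      (fun y : ℝ => (η - A * k ^ 2) * y - B * k * y ^ 2 / 2 - C * y ^ 3 / 3)
      (η - quad A B C k y) y := by
    intro y _
    refine ((((hasDerivAt_id y).const_mul (η - A * k ^ 2)).sub
      (((hasDerivAt_pow 2 y).const_mul (B * k)).div_const 2)).sub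
      (((hasDerivAt_pow 3 y).const_mul C).div_const 3)).congr_deriv ?_
    unfold quad
    push_cast
    ring
  rw [intervalIntegral.integral_eq_sub_of_hasDerivAt h
    (Continuous.intervalIntegrable (by unfold quad; fun_prop) _ _)]
  ring

/-- The part of the plane near the points where the lines `x = ± κ` meet the unit circle. -/
def nearCorner (κ K L ρ : ℝ) : Set (ℝ × ℝ) :=
  {v | |(|v.1| - κ)| ≤ K * ρ ∧ |v.2 ^ 2 - (1 - κ ^ 2)| ≤ L * ρ}

theorem setOf_abs_abs_sub_le_subset (κ t : ℝ) :
    {x : ℝ | |(|x| - κ)| ≤ t} ⊆ Icc (κ - t) (κ + t) ∪ Icc (-(κ + t)) (-(κ - t)) := by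
  intro x hx
  have h := abs_le.1 (show |(|x| - κ)| ≤ t from hx)
  rcases abs_cases x with h' | h'
  · exact Or.inl ⟨by linarith, by linarith⟩
  · exact Or.inr ⟨by linarith, by linarith⟩

theorem setOf_abs_sq_sub_le_subset (m t : ℝ) : {y : ℝ | |y ^ 2 - m| ≤ t} ⊆
    Icc √(m - t) √(m + t) ∪ Icc (-√(m + t)) (-√(m - t)) := by
  intro y hy
  have h := abs_le.1 (show |y ^ 2 - m| ≤ t from hy)
  have h1 : √(m - t) ≤ |y| := Real.sqrt_le_iff.2 ⟨abs_nonneg y, by rw [sq_abs]; linarith⟩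
  have h2 : |y| ≤ √(m + t) := Real.abs_le_sqrt (by linarith)
  rcases abs_cases y with h' | h'
  · exact Or.inl ⟨by linarith, by linarith⟩
  · exact Or.inr ⟨by linarith, by linarith⟩

theorem volume_real_Icc_union_Icc_neg_le {a b : ℝ} (h : a ≤ b) :
    volume.real (Icc a b ∪ Icc (-b) (-a)) ≤ 2 * (b - a) := by
  refine (measureReal_union_le _ _).trans ?_
  rw [Real.volume_real_Icc_of_le h, Real.volume_real_Icc_of_le (neg_le_neg h)]
  linarith

theorem volume_nearCorner (κ : ℝ) (hK : 0 ≤ K) (hL : 0 ≤ L) (hρ : 0 ≤ ρ) :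
    volume (nearCorner κ K L ρ) ≠ ⊤ ∧ volume.real (nearCorner κ K L ρ) ≤
      4 * (K * ρ) * (2 * (√(1 - κ ^ 2 + L * ρ) - √(1 - κ ^ 2 - L * ρ))) := by
  have hKρ : 0 ≤ K * ρ := by positivity
  have hLρ : 0 ≤ L * ρ := by positivity
  set S := Icc (κ - K * ρ) (κ + K * ρ) ∪ Icc (-(κ + K * ρ)) (-(κ - K * ρ))
  set T := Icc √(1 - κ ^ 2 - L * ρ) √(1 - κ ^ 2 + L * ρ) ∪
    Icc (-√(1 - κ ^ 2 + L * ρ)) (-√(1 - κ ^ 2 - L * ρ))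
  have hS : volume S ≠ ⊤ := (measure_union_lt_top measure_Icc_lt_top measure_Icc_lt_top).ne
  have hT : volume T ≠ ⊤ := (measure_union_lt_top measure_Icc_lt_top measure_Icc_lt_top).ne
  have hsub : nearCorner κ K L ρ ⊆ S ×ˢ T := fun v hv =>
    ⟨setOf_abs_abs_sub_le_subset _ _ hv.1, setOf_abs_sq_sub_le_subset _ _ hv.2⟩
  have hST : volume (S ×ˢ T) ≠ ⊤ := by
    rw [Measure.volume_eq_prod, Measure.prod_prod]
    exact ENNReal.mul_ne_top hS hT
  refine ⟨ne_top_of_le_ne_top hST (measure_mono hsub), (measureReal_mono hsub hST).trans ?_⟩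
  rw [Measure.volume_eq_prod, measureReal_prod_prod]
  have h1 : volume.real S ≤ 4 * (K * ρ) :=
    (volume_real_Icc_union_Icc_neg_le (by linarith)).trans_eq (by ring)
  have h2 := volume_real_Icc_union_Icc_neg_le (Real.sqrt_le_sqrt
    (show 1 - κ ^ 2 - L * ρ ≤ 1 - κ ^ 2 + L * ρ by linarith))
  exact mul_le_mul h1 h2 measureReal_nonneg (by positivity)

/-- The width is `O(ρ)` and the height tends to `0`, so the area is `o(ρ)`. This includes the
tangential case `κ = 1`, where the height is only of order `√ρ`. -/
theorem tendsto_volume_nearCorner (κ : ℝ) (hK : 0 ≤ K) (hL : 0 ≤ L) :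
    Tendsto (fun ρ : ℝ => volume.real (nearCorner κ K L ρ) / ρ) (𝓝[>] 0) (𝓝 0) := by
  have h : Tendsto (fun ρ : ℝ => 4 * K * (2 * (√(1 - κ ^ 2 + L * ρ) - √(1 - κ ^ 2 - L * ρ))))
      (𝓝[>] 0) (𝓝 0) := by
    have hc : Continuous fun ρ : ℝ =>
        4 * K * (2 * (√(1 - κ ^ 2 + L * ρ) - √(1 - κ ^ 2 - L * ρ))) := by fun_prop
    simpa using (hc.tendsto 0).mono_left nhdsWithin_le_nhds
  refine squeeze_zero' ?_ ?_ h
  · filter_upwards [self_mem_nhdsWithin] with ρ hρ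
    exact div_nonneg measureReal_nonneg (le_of_lt hρ)
  · filter_upwards [self_mem_nhdsWithin] with ρ hρ
    have hρ : 0 < ρ := hρ
    rw [div_le_iff₀ hρ]
    exact (volume_nearCorner κ hK hL hρ.le).2.trans_eq (by ring)

theorem volume_real_le_diskPart_sub {S : Set (ℝ × ℝ)} {τ₁ τ₂ : ℝ} (h : τ₁ ≤ τ₂)
    (hS : ∀ v ∈ S, v.1 ^ 2 + v.2 ^ 2 ≤ 1 ∧ τ₁ < v.1 + ρ * quad A B C v.1 v.2 ∧
      v.1 + ρ * quad A B C v.1 v.2 ≤ τ₂) :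
    volume.real S ≤ volume.real (diskPart A B C ρ τ₂) - volume.real (diskPart A B C ρ τ₁) := by
  have hsub : diskPart A B C ρ τ₁ ⊆ diskPart A B C ρ τ₂ := fun v hv => ⟨hv.1, hv.2.trans h⟩
  rw [← measureReal_sdiff hsub measurableSet_diskPart
    (volume_ne_top_of_subset_unitDisk diskPart_subset)]
  refine measureReal_mono (fun v hv => ?_)
    (volume_ne_top_of_subset_unitDisk (sdiff_subset.trans diskPart_subset))
  obtain ⟨h1, h2, h3⟩ := hS v hv
  exact ⟨⟨h1, h3⟩, fun hv' => (not_le.2 h2) hv'.2⟩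

theorem diskPart_sub_le_volume_real {S : Set (ℝ × ℝ)} {τ₁ τ₂ : ℝ} (h : τ₁ ≤ τ₂)
    (hfin : volume S ≠ ⊤)
    (hS : ∀ v : ℝ × ℝ, v.1 ^ 2 + v.2 ^ 2 ≤ 1 → τ₁ < v.1 + ρ * quad A B C v.1 v.2 →
      v.1 + ρ * quad A B C v.1 v.2 ≤ τ₂ → v ∈ S) :
    volume.real (diskPart A B C ρ τ₂) - volume.real (diskPart A B C ρ τ₁) ≤ volume.real S := by
  have hsub : diskPart A B C ρ τ₁ ⊆ diskPart A B C ρ τ₂ := fun v hv => ⟨hv.1, hv.2.trans h⟩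
  rw [← measureReal_sdiff hsub measurableSet_diskPart
    (volume_ne_top_of_subset_unitDisk diskPart_subset)]
  refine measureReal_mono (fun v hv => ?_) hfin
  exact hS v hv.1.1 (not_le.1 fun h => hv.2 ⟨hv.1.1, h⟩) hv.1.2

/-- Within the unit disk cut by the strip `|x| ≤ κ`, under a quadratic perturbation of size `ρ`,
the level `ρ σ` exceeds the median as soon as `σ` exceeds its first order coefficient. -/
theorem exists_volume_lt (hκ : 0 < κ)
    (hσ : C / 3 * (1 - √(1 - κ ^ 2) ^ 3) - √(1 - κ ^ 2) * A * κ ^ 2 < σ) :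
    ∃ η > 0, ∀ K L : ℝ, 0 ≤ K → 0 ≤ L → ∀ᶠ ρ : ℝ in 𝓝[>] 0, ∀ S T : Set (ℝ × ℝ),
      (∀ v ∈ S, v.1 ^ 2 + v.2 ^ 2 ≤ 1 ∧ |v.1 + ρ * quad A B C v.1 v.2| ≤ κ + ρ * η) →
      volume T ≠ ⊤ →
      (∀ v : ℝ × ℝ, v.1 ^ 2 + v.2 ^ 2 ≤ 1 → -κ + ρ * η < v.1 + ρ * quad A B C v.1 v.2 →
        v.1 + ρ * quad A B C v.1 v.2 ≤ ρ * (σ - η) → v ∉ nearCorner κ K L ρ → v ≠ 0 → v ∈ T) →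
      volume.real S < 2 * volume.real T := by
  set Y := √(1 - κ ^ 2)
  -- The divisor `20` is generous: all slack terms together leave the limit `76 η - 10 Y η`, at
  -- least `66 η`.
  set η := (σ - (C / 3 * (1 - Y ^ 3) - Y * A * κ ^ 2)) / 20 with hη
  have hη0 : 0 < η := by
    rw [hη]
    linarith
  refine ⟨η, hη0, fun K L hK hL => ?_⟩
  have hY1 : Y ≤ 1 := Real.sqrt_le_one.2 (by nlinarith)
  have t0 := tendsto_volume_diskPart A B C 0 (σ - η)
  have t1 := tendsto_volume_diskPart A B C (-κ) η
  have t2 := tendsto_volume_diskPart A B C κ η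
  have t3 := tendsto_volume_diskPart A B C (-κ) (-(2 * η))
  have t4 := tendsto_volume_nearCorner κ hK hL
  rw [integral_sub_quad] at t0 t1 t2 t3
  simp only [neg_sq] at t1 t3
  have ht := ((((t0.sub t1).const_mul 2).sub (t2.sub t3)).sub (t4.const_mul 2))
  have hpos := ht.eventually (lt_mem_nhds (a := 0) (by
    have hYη : Y * η ≤ 1 * η := by gcongr
    have hσ' : σ = C / 3 * (1 - Y ^ 3) - Y * A * κ ^ 2 + 20 * η := by
      rw [hη]
      ring
    have : 2 * (2 * √(1 - 0 ^ 2) * (σ - η) - 2 * √(1 - 0 ^ 2) * (A * 0 ^ 2) -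
        2 / 3 * C * √(1 - 0 ^ 2) ^ 3 -
        (2 * Y * η - 2 * Y * (A * κ ^ 2) - 2 / 3 * C * Y ^ 3)) -
        (2 * Y * η - 2 * Y * (A * κ ^ 2) - 2 / 3 * C * Y ^ 3 -
          (2 * Y * -(2 * η) - 2 * Y * (A * κ ^ 2) - 2 / 3 * C * Y ^ 3)) - 2 * 0 =
        76 * η - 10 * (Y * η) := by
      norm_num
      rw [hσ']
      ring
    linarith))
  have hsmall : ∀ c : ℝ, Tendsto (fun ρ : ℝ => -κ + ρ * c) (𝓝[>] 0) (𝓝 (-κ)) := fun c => by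
    have hc : Continuous fun ρ : ℝ => -κ + ρ * c := by fun_prop
    simpa using (hc.tendsto 0).mono_left nhdsWithin_le_nhds
  filter_upwards [hpos, (hsmall (η - (σ - η))).eventually (gt_mem_nhds (neg_lt_zero.2 hκ)),
    self_mem_nhdsWithin] with ρ h1 h2 hρ S T hS hT hST
  have hρ : 0 < ρ := hρ
  have hρη : 0 < ρ * η := by positivity
  -- The lower level has slack `2 η` instead of `η` because differences of disk parts need a strict
  -- lower inequality.
  have b1 := volume_real_le_diskPart_sub (A := A) (B := B) (C := C) (ρ := ρ) (S := S)
    (τ₁ := -κ + ρ * -(2 * η)) (τ₂ := κ + ρ * η) (by linarith) fun v hv => by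
      obtain ⟨h3, h4⟩ := hS v hv
      have h5 := abs_le.1 h4
      exact ⟨h3, by linarith, h5.2⟩
  obtain ⟨hN, -⟩ := volume_nearCorner κ hK hL hρ.le
  -- The centre is set aside since the segment to it is constant, hence not regular; a single point
  -- has no area.
  have b2 := diskPart_sub_le_volume_real (A := A) (B := B) (C := C) (ρ := ρ)
    (S := T ∪ (nearCorner κ K L ρ ∪ {0})) (τ₁ := -κ + ρ * η) (τ₂ := 0 + ρ * (σ - η)) (by linarith)
    (measure_union_lt_top hT.lt_top (measure_union_lt_top hN.lt_top (by simp))).ne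
    fun v h3 h4 h5 => by
      by_cases h6 : v ∈ nearCorner κ K L ρ
      · exact Or.inr (Or.inl h6)
      by_cases h7 : v = 0
      · exact Or.inr (Or.inr h7)
      exact Or.inl (hST v h3 h4 (by linarith) h6 h7)
  have b3 : volume.real (T ∪ (nearCorner κ K L ρ ∪ {0})) ≤
      volume.real T + volume.real (nearCorner κ K L ρ) := by
    refine (measureReal_union_le _ _).trans (add_le_add_right ?_ _)
    refine (measureReal_union_le _ _).trans_eq ?_
    simp [measureReal_def]
  -- The order zero areas cancel: twice the half disk equals the sum of the segments cut at `κ` and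
  -- `-κ`.
  have e1 := volume_diskPart_zero_add A B C κ
  have e2 := volume_diskPart_zero_add A B C 0
  rw [neg_zero] at e2
  rw [show ∀ a b c d e : ℝ, 2 * (a / ρ - b / ρ) - (c / ρ - d / ρ) - 2 * (e / ρ) =
    (2 * (a - b) - (c - d) - 2 * e) / ρ from fun a b c d e => by ring] at h1
  have h6 := (div_pos_iff_of_pos_right hρ).1 h1
  linarith

end DiskParts

/-! ### Local expansion of the image -/

section Local

variable {Ω : Set Plane} {u : Plane → ℝ} {x₀ x h : Plane}

theorem inner_gradient (u : Plane → ℝ) (x h : Plane) :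
    inner ℝ (gradient u x) h = fderiv ℝ u x h :=
  InnerProductSpace.toDual_symm_apply

theorem gradient_apply (u : Plane → ℝ) (x : Plane) (i : Fin 2) :
    gradient u x i = fderiv ℝ u x (EuclideanSpace.single i 1) := by
  rw [← inner_gradient, real_inner_comm, EuclideanSpace.inner_single_left]
  simp

theorem contDiffAt_of_mem_interior (hu : ContDiffOn ℝ ∞ u Ω) (hx : x ∈ interior Ω) :
    ContDiffAt ℝ ∞ u x := hu.contDiffAt (mem_interior_iff_mem_nhds.1 hx)

theorem differentiableAt_gradient (hu : ContDiffAt ℝ ∞ u x) :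
    DifferentiableAt ℝ (gradient u) x := by
  rw [differentiableAt_euclidean]
  intro i
  simp only [gradient_apply]
  have h : ContDiffAt ℝ ∞ (fderiv ℝ u) x := hu.fderiv_right (by simp)
  exact (h.differentiableAt (by simp)).clm_apply (differentiableAt_const _)

theorem exists_ball_subset (hu : ContDiffOn ℝ ∞ u Ω) (hx : x₀ ∈ interior Ω) :
    ∃ r > 0, Metric.ball x₀ r ⊆ Ω ∧ ∀ x ∈ Metric.ball x₀ r, DifferentiableAt ℝ u x := by
  obtain ⟨r, hr, h⟩ := Metric.isOpen_iff.1 isOpen_interior x₀ hx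
  exact ⟨r, hr, h.trans interior_subset, fun x hx =>
    (contDiffAt_of_mem_interior hu (h hx)).differentiableAt (by simp)⟩

variable {H : Plane →L[ℝ] Plane} {G : Plane → Plane}

theorem exists_norm_sub_le (hG : HasFDerivAt G H x₀) {η : ℝ} (hη : 0 < η) :
    ∃ r > 0, ∀ h, ‖h‖ < r → ‖G (x₀ + h) - G x₀ - H h‖ ≤ η * ‖h‖ := by
  have h := (hasFDerivAt_iff_isLittleO_nhds_zero.1 hG).def hη
  obtain ⟨r, hr, hr'⟩ := Metric.eventually_nhds_iff.1 h
  exact ⟨r, hr, fun h hh => hr' (by simpa using hh)⟩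

theorem exists_lipschitz (hG : HasFDerivAt G H x₀) :
    ∃ K > 0, ∃ r > 0, ∀ h, ‖h‖ < r → ‖G (x₀ + h) - G x₀‖ ≤ K * ‖h‖ := by
  obtain ⟨r, hr, hr'⟩ := exists_norm_sub_le hG one_pos
  refine ⟨1 + ‖H‖, by positivity, r, hr, fun h hh => ?_⟩
  rw [add_mul]
  refine (norm_le_norm_sub_add _ (H h)).trans ?_
  exact add_le_add (hr' h hh) (H.le_opNorm h)

/-- The second order Taylor expansion of a function in terms of the derivative of its gradient. -/
theorem exists_taylor (hG : HasFDerivAt (gradient u) H x₀) {R : ℝ} (hR : 0 < R)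
    (hd : ∀ x ∈ Metric.ball x₀ R, DifferentiableAt ℝ u x) {η : ℝ} (hη : 0 < η) :
    ∃ r > 0, ∀ h, ‖h‖ < r → |u (x₀ + h) - u x₀ - inner ℝ (gradient u x₀) h -
      inner ℝ (H h) h / 2| ≤ η * ‖h‖ ^ 2 := by
  obtain ⟨r, hr, hr'⟩ := exists_norm_sub_le hG hη
  refine ⟨min r R, lt_min hr hR, fun h hh => ?_⟩
  obtain ⟨hhr, hhR⟩ := lt_min_iff.1 hh
  have hle : ∀ t ∈ Icc (0 : ℝ) 1, ‖t • h‖ ≤ ‖h‖ := fun t ht => by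
    rw [norm_smul, Real.norm_of_nonneg ht.1]
    exact mul_le_of_le_one_left (norm_nonneg h) ht.2
  -- Along the segment, the derivative of the Taylor remainder is the first order remainder of the
  -- gradient paired with `h`; the mean value inequality then suffices.
  have hder : ∀ t ∈ Icc (0 : ℝ) 1, HasDerivWithinAt
      (fun t : ℝ => u (x₀ + t • h) - t * inner ℝ (gradient u x₀) h - t ^ 2 * (inner ℝ (H h) h / 2))
      (inner ℝ (gradient u (x₀ + t • h) - gradient u x₀ - H (t • h)) h) (Icc 0 1) t := by
    intro t ht
    have hdt : DifferentiableAt ℝ u (x₀ + t • h) := hd _ (by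
      rw [mem_ball_iff_norm, add_sub_cancel_left]
      exact (hle t ht).trans_lt hhR)
    refine (((hasDerivWithinAt_comp_segment hdt _).sub
      ((hasDerivWithinAt_id t _).mul_const _)).sub
      ((hasDerivAt_pow 2 t).hasDerivWithinAt.mul_const _)).congr_deriv ?_
    rw [inner_sub_left, inner_sub_left, inner_gradient, map_smul, inner_smul_left]
    simp
    ring
  have h := norm_image_sub_le_of_norm_deriv_le_segment_01' hder (C := η * ‖h‖ ^ 2) fun t ht => by
    have ht' : t ∈ Icc (0 : ℝ) 1 := Ico_subset_Icc_self ht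
    refine (norm_inner_le_norm _ _).trans ?_
    rw [sq, ← mul_assoc]
    gcongr
    refine (hr' _ ((hle t ht').trans_lt hhr)).trans ?_
    gcongr
    exact hle t ht'
  rw [Real.norm_eq_abs] at h
  refine le_of_eq_of_le ?_ h
  congr 1
  simp
  ring

end Local

/-! ### Scaled coordinates -/

section Frame

/-- The point with coordinates `ρ v` in the orthonormal frame `b` at `x₀`. -/
noncomputable def framePoint (x₀ : Plane) (b : OrthonormalBasis (Fin 2) ℝ Plane) (ρ : ℝ)
    (v : ℝ × ℝ) : Plane := x₀ + ρ • (v.1 • b 0 + v.2 • b 1)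

variable {x₀ : Plane} {b : OrthonormalBasis (Fin 2) ℝ Plane} {ρ : ℝ} {v : ℝ × ℝ}

theorem inner_frame_zero_one (b : OrthonormalBasis (Fin 2) ℝ Plane) : inner ℝ (b 0) (b 1) = 0 :=
  b.orthonormal.2 (by simp)

theorem inner_frame_self (b : OrthonormalBasis (Fin 2) ℝ Plane) (i : Fin 2) :
    inner ℝ (b i) (b i) = 1 := by
  rw [real_inner_self_eq_norm_sq, b.orthonormal.1 i, one_pow]

theorem norm_frame_sq (b : OrthonormalBasis (Fin 2) ℝ Plane) (v : ℝ × ℝ) :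
    ‖v.1 • b 0 + v.2 • b 1‖ ^ 2 = v.1 ^ 2 + v.2 ^ 2 := by
  rw [norm_add_sq_real, norm_smul, norm_smul, inner_smul_left, inner_smul_right,
    inner_frame_zero_one, b.orthonormal.1, b.orthonormal.1]
  simp

theorem inner_frame_zero (b : OrthonormalBasis (Fin 2) ℝ Plane) (v : ℝ × ℝ) :
    inner ℝ (b 0) (v.1 • b 0 + v.2 • b 1) = v.1 := by
  rw [inner_add_right, inner_smul_right, inner_smul_right, inner_frame_zero_one, inner_frame_self]
  simp

theorem exists_framePoint_eq (x₀ : Plane) (b : OrthonormalBasis (Fin 2) ℝ Plane) (hρ : ρ ≠ 0)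
    (x : Plane) : ∃ v, framePoint x₀ b ρ v = x := by
  refine ⟨(inner ℝ (b 0) (ρ⁻¹ • (x - x₀)), inner ℝ (b 1) (ρ⁻¹ • (x - x₀))), ?_⟩
  have h := b.sum_repr' (ρ⁻¹ • (x - x₀))
  rw [Fin.sum_univ_two] at h
  rw [framePoint, h, smul_inv_smul₀ hρ, add_sub_cancel]

open scoped Pointwise in
theorem volume_framePoint_image (x₀ : Plane) (b : OrthonormalBasis (Fin 2) ℝ Plane) (ρ : ℝ)
    (S : Set (ℝ × ℝ)) :
    volume (framePoint x₀ b ρ '' S) = ENNReal.ofReal (ρ ^ 2) * volume S := by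
  let e : ℝ × ℝ ≃ᵐ Plane := (MeasurableEquiv.finTwoArrow.symm.trans
    (MeasurableEquiv.toLp 2 (Fin 2 → ℝ))).trans b.measurableEquiv.symm
  have he : MeasurePreserving e :=
    b.measurePreserving_repr_symm.comp ((PiLp.volume_preserving_toLp (Fin 2)).comp
      ((volume_preserving_finTwoArrow ℝ).symm _))
  have hev : ∀ v, e v = v.1 • b 0 + v.2 • b 1 := fun v => by
    have : e v = b.repr.symm (WithLp.toLp 2 ![v.1, v.2]) := rfl
    rw [this, ← b.sum_repr_symm, Fin.sum_univ_two]
    simp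
  have himage : framePoint x₀ b ρ '' S = (fun y => x₀ + y) '' (ρ • (e '' S)) := by
    rw [← image_smul, image_image, image_image]
    exact image_congr fun v _ => by rw [framePoint, hev]
  rw [himage, image_add_left, measure_preimage_add, Measure.addHaar_smul,
    e.image_eq_preimage_symm, (he.symm e).measure_preimage_equiv]
  simp

end Frame

/-! ### The amoeba in scaled coordinates -/

section Scaled

variable {Ω : Set Plane} {u : Plane → ℝ} {x₀ : Plane} {b : OrthonormalBasis (Fin 2) ℝ Plane}
  {β z ρ r K : ℝ} {v : ℝ × ℝ}

/-- Away from the corners of the strip-cut disk, straight segments realise the amoeba distance. -/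
theorem framePoint_mem_amoeba (hβ : 0 < β) (hu : ContDiffOn ℝ ∞ u Ω) (hz : 0 < z)
    (hb : gradient u x₀ = z • b 0) (hball : Metric.ball x₀ r ⊆ Ω)
    (hd : ∀ x ∈ Metric.ball x₀ r, DifferentiableAt ℝ u x) (hK : 0 ≤ K)
    (hlip : ∀ h, ‖h‖ < r → ‖gradient u (x₀ + h) - gradient u x₀‖ ≤ z * K * ‖h‖)
    (hρ : 0 < ρ) (hρ1 : ρ ≤ 1) (hρr : ρ < r) (hv : v.1 ^ 2 + v.2 ^ 2 ≤ 1) (hv0 : v ≠ 0)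
    (hq : β * |u (framePoint x₀ b ρ v) - u x₀| ≤ ρ)
    (hcorner : v ∉ nearCorner (1 / (β * z)) K (4 * K / (1 / (β * z)) +
      K * (2 * (1 / (β * z)) + K)) ρ) :
    framePoint x₀ b ρ v ∈ amoeba nuInf β Ω u ρ x₀ := by
  set κ := 1 / (β * z) with hκ
  have hκ0 : 0 < κ := by positivity
  have hβzκ : β * z * κ = 1 := by
    rw [hκ]
    field_simp
  set E := v.1 • b 0 + v.2 • b 1 with hE
  set n := ‖E‖ with hn
  have hnv : n ^ 2 = v.1 ^ 2 + v.2 ^ 2 := norm_frame_sq b v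
  have hn0 : 0 ≤ n := norm_nonneg _
  have hn1 : n ≤ 1 := by nlinarith
  have hE0 : E ≠ 0 := by
    intro h0
    rw [hn, h0, norm_zero] at hnv
    refine hv0 (Prod.ext ?_ ?_)
    · exact pow_eq_zero_iff (two_ne_zero) |>.1 (show v.1 ^ 2 = 0 by nlinarith)
    · exact pow_eq_zero_iff (two_ne_zero) |>.1 (show v.2 ^ 2 = 0 by nlinarith)
  set h := ρ • E with hh
  have hnorm : ‖h‖ = ρ * n := by rw [hh, norm_smul, Real.norm_of_nonneg hρ.le]
  have hnormρ : ‖h‖ ≤ ρ := hnorm.trans_le (mul_le_of_le_one_right hρ.le hn1)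
  have hh0 : h ≠ 0 := smul_ne_zero hρ.ne' hE0
  have hnt : ∀ t ∈ Icc (0 : ℝ) 1, ‖t • h‖ ≤ ρ := fun t ht => by
    rw [norm_smul, Real.norm_of_nonneg ht.1]
    exact (mul_le_of_le_one_left (norm_nonneg h) ht.2).trans hnormρ
  have hmem : ∀ t ∈ Icc (0 : ℝ) 1, x₀ + t • h ∈ Metric.ball x₀ r := fun t ht => by
    rw [mem_ball_iff_norm, add_sub_cancel_left]
    exact (hnt t ht).trans_lt hρr
  have hF : ∀ t ∈ Icc (0 : ℝ) 1,
      |fderiv ℝ u (x₀ + t • h) h - z * ρ * v.1| ≤ z * ρ * (K * ρ) := by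
    intro t ht
    have h1 : fderiv ℝ u (x₀ + t • h) h - z * ρ * v.1 =
        inner ℝ (gradient u (x₀ + t • h) - gradient u x₀) h := by
      rw [inner_sub_left, inner_gradient, hb, hh, inner_smul_left, inner_smul_right, hE,
        inner_frame_zero]
      simp
      ring
    rw [h1]
    refine (abs_real_inner_le_norm _ _).trans ?_
    calc ‖gradient u (x₀ + t • h) - gradient u x₀‖ * ‖h‖ ≤ z * K * ‖t • h‖ * ‖h‖ := by
          gcongr
          exact hlip _ ((hnt t ht).trans_lt hρr)
      _ ≤ z * K * ρ * ρ := by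
          gcongr
          exact hnt t ht
      _ = z * ρ * (K * ρ) := by ring
  have hΩ := fun t ht => hball (hmem t ht)
  have hd' := fun t ht => hd _ (hmem t ht)
  -- The contrast speed stays at most `ρ` along the whole segment.
  by_cases c1 : |v.1| + K * ρ ≤ κ
  · refine mem_amoeba_of_max_le hβ hh0 hΩ hd' fun t ht => max_le hnormρ ?_
    have h1 : |fderiv ℝ u (x₀ + t • h) h| ≤ z * ρ * κ := by
      have h2 : |z * ρ * v.1| = z * ρ * |v.1| := by rw [abs_mul, abs_of_pos (by positivity)]
      calc |fderiv ℝ u (x₀ + t • h) h|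
          ≤ |fderiv ℝ u (x₀ + t • h) h - z * ρ * v.1| + |z * ρ * v.1| := by
            simpa using abs_add_le (fderiv ℝ u (x₀ + t • h) h - z * ρ * v.1) (z * ρ * v.1)
        _ ≤ z * ρ * (K * ρ) + z * ρ * |v.1| := add_le_add (hF t ht) h2.le
        _ = z * ρ * (|v.1| + K * ρ) := by ring
        _ ≤ _ := by gcongr
    calc β * |fderiv ℝ u (x₀ + t • h) h| ≤ β * (z * ρ * κ) := by gcongr
      _ = β * z * κ * ρ := by ring
      _ = ρ := by rw [hβzκ, one_mul]
  -- The contrast speed dominates the spatial speed along the whole segment, with the sign of `v.1`.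
  by_cases c2 : κ * n ≤ |v.1| - K * ρ
  · have key : ∀ σ : ℝ, |σ| = 1 → σ * v.1 = |v.1| → x₀ + h ∈ amoeba nuInf β Ω u ρ x₀ := by
      intro σ hσ hσv
      refine mem_amoeba_of_norm_le hβ hu hh0 hΩ hd' hσ (fun t ht => ?_) hq
      have h1 : z * ρ * (|v.1| - K * ρ) ≤ σ * fderiv ℝ u (x₀ + t • h) h := by
        have h2 : |σ * (fderiv ℝ u (x₀ + t • h) h - z * ρ * v.1)| ≤ z * ρ * (K * ρ) := by
          rw [abs_mul, hσ, one_mul]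
          exact hF t ht
        have h3 := (abs_le.1 h2).1
        have h4 : σ * (z * ρ * v.1) = z * ρ * |v.1| := by rw [← hσv]; ring
        rw [mul_sub σ, h4] at h3
        linarith
      calc ‖h‖ = β * z * κ * (ρ * n) := by rw [hβzκ, one_mul, hnorm]
        _ = β * (z * ρ * (κ * n)) := by ring
        _ ≤ β * (z * ρ * (|v.1| - K * ρ)) := by gcongr
        _ ≤ _ := by gcongr
    rcases abs_cases v.1 with ⟨h', -⟩ | ⟨h', -⟩
    · exact key 1 (by simp) (by rw [h', one_mul])
    · exact key (-1) (by simp) (by rw [h', neg_one_mul])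
  -- Failure of both cases forces `|v.1|` to within `K ρ` of `κ` and `1 - n < 2 K ρ / κ`. Then `v.2
  -- ^ 2 = n ^ 2 - v.1 ^ 2` lies near `1 - κ ^ 2`: the two summands of the corner constant bound `1
  -- - n ^ 2` and `|v.1 ^ 2 - κ ^ 2|`.
  · refine absurd ⟨?_, ?_⟩ hcorner
    · rw [not_le] at c1 c2
      have : κ * n ≤ κ := mul_le_of_le_one_right hκ0.le hn1
      exact abs_le.2 ⟨by linarith, by linarith⟩
    · rw [not_le] at c1 c2
      have h1 : κ * n ≤ κ := mul_le_of_le_one_right hκ0.le hn1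
      have hKρ : 0 ≤ K * ρ := by positivity
      have h2 : |(|v.1| - κ)| ≤ K * ρ := abs_le.2 ⟨by linarith, by linarith⟩
      have h3 : |(|v.1| - κ) * (|v.1| + κ)| ≤ K * ρ * (2 * κ + K) := by
        rw [abs_mul, abs_of_nonneg (show 0 ≤ |v.1| + κ by positivity)]
        have : K * ρ ≤ K := mul_le_of_le_one_right hK hρ1
        exact mul_le_mul h2 (by linarith) (by positivity) hKρ
      have h4 : (|v.1| - κ) * (|v.1| + κ) = v.1 ^ 2 - κ ^ 2 := by rw [← sq_abs v.1]; ring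
      have h5 : 1 - n ≤ 2 * K / κ * ρ := by
        rw [div_mul_eq_mul_div, le_div_iff₀ hκ0]
        linarith
      have h6 : 4 * K / κ * ρ = 2 * (2 * K / κ * ρ) := by ring
      rw [h4] at h3
      have h7 := abs_le.1 h3
      rw [abs_le, add_mul, h6]
      constructor <;> nlinarith

/-- For small radii, more than half of the area of the amoeba lies below every level whose second
order coefficient exceeds the one of the median. -/
theorem eventually_volume_amoeba_lt (hβ : 0 < β) (hu : ContDiffOn ℝ ∞ u Ω)
    (hx : x₀ ∈ interior Ω) (hz : 0 < z) (hb : gradient u x₀ = z • b 0) {H : Plane →L[ℝ] Plane}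
    (hH : HasFDerivAt (gradient u) H x₀) {κ s : ℝ} (hκ : κ = 1 / (β * z))
    (hs : (inner ℝ (H (b 1)) (b 1) * (1 - √(1 - κ ^ 2) ^ 3) -
      3 * κ ^ 2 * √(1 - κ ^ 2) * inner ℝ (H (b 0)) (b 0)) / 6 < s) :
    ∀ᶠ ρ : ℝ in 𝓝[>] 0, volume (amoeba nuInf β Ω u ρ x₀) <
      2 * volume {x ∈ amoeba nuInf β Ω u ρ x₀ | u x ≤ u x₀ + ρ ^ 2 * s} := by
  have hκ0 : 0 < κ := by
    rw [hκ]
    positivity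
  set A := inner ℝ (H (b 0)) (b 0) / (2 * z)
  -- Symmetry of the Hessian is not needed, as `B` does not affect the median to this order.
  set B := (inner ℝ (H (b 0)) (b 1) + inner ℝ (H (b 1)) (b 0)) / (2 * z)
  set C := inner ℝ (H (b 1)) (b 1) / (2 * z)
  obtain ⟨η, hη, harea⟩ := exists_volume_lt (A := A) (B := B) (C := C) (σ := s / z) hκ0 (by
    rw [lt_div_iff₀ hz]
    refine lt_of_eq_of_lt ?_ hs
    simp only [A, C]
    field_simp
    ring)
  obtain ⟨r₁, hr₁, hball, hd⟩ := exists_ball_subset hu hx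
  obtain ⟨K', hK', r₂, hr₂, hlip⟩ := exists_lipschitz hH
  obtain ⟨r₃, hr₃, htaylor⟩ := exists_taylor hH hr₁ hd (show 0 < z * η by positivity)
  set K := K' / z with hKdef
  have hK : 0 < K := by positivity
  have hzK : z * K = K' := by
    rw [hKdef]
    field_simp
  set L := 4 * K / κ + K * (2 * κ + K) with hL
  have hlim : Tendsto (fun ρ : ℝ => ρ * (s / z)) (𝓝[>] 0) (𝓝 0) := by
    have hc : Continuous fun ρ : ℝ => ρ * (s / z) := by fun_prop
    simpa using (hc.tendsto 0).mono_left nhdsWithin_le_nhds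
  have hlt : ∀ {a : ℝ}, 0 < a → ∀ᶠ ρ : ℝ in 𝓝[>] 0, ρ < a := fun ha =>
    mem_nhdsWithin_of_mem_nhds (gt_mem_nhds ha)
  filter_upwards [harea K L hK.le (by positivity), hlt one_pos, hlt hr₁, hlt hr₂, hlt hr₃,
    hlim.eventually (gt_mem_nhds hκ0), self_mem_nhdsWithin]
    with ρ hρarea hρ1 hρr₁ hρr₂ hρr₃ hρκ hρ
  have hρ : 0 < ρ := hρ
  have hβz : β * (z * κ) = 1 := by
    rw [hκ]
    field_simp
  set w : ℝ × ℝ → ℝ := fun v => (u (framePoint x₀ b ρ v) - u x₀) / (z * ρ) with hw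
  have hwu : ∀ v, u (framePoint x₀ b ρ v) - u x₀ = z * ρ * w v := fun v => by
    rw [hw]
    field_simp
  have hwκ : ∀ v, β * |u (framePoint x₀ b ρ v) - u x₀| ≤ ρ ↔ |w v| ≤ κ := fun v => by
    rw [hwu, abs_mul, abs_of_pos (show 0 < z * ρ by positivity)]
    rw [show β * (z * ρ * |w v|) = (β * z * |w v|) * ρ by ring, mul_le_iff_le_one_left hρ,
      ← hβz, ← mul_assoc, mul_le_mul_iff_right₀ (by positivity)]
  have happrox : ∀ v : ℝ × ℝ, v.1 ^ 2 + v.2 ^ 2 ≤ 1 →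
      |w v - (v.1 + ρ * quad A B C v.1 v.2)| ≤ ρ * η := by
    intro v hv
    have hE := norm_frame_sq b v
    have hE1 : ‖v.1 • b 0 + v.2 • b 1‖ ≤ 1 := by
      nlinarith [norm_nonneg (v.1 • b 0 + v.2 • b 1)]
    have hnorm : ‖ρ • (v.1 • b 0 + v.2 • b 1)‖ ≤ ρ := by
      rw [norm_smul, Real.norm_of_nonneg hρ.le]
      exact mul_le_of_le_one_right hρ.le hE1
    have h := htaylor _ (hnorm.trans_lt hρr₃)
    have heq : u (x₀ + ρ • (v.1 • b 0 + v.2 • b 1)) - u x₀ -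
        inner ℝ (gradient u x₀) (ρ • (v.1 • b 0 + v.2 • b 1)) -
        inner ℝ (H (ρ • (v.1 • b 0 + v.2 • b 1))) (ρ • (v.1 • b 0 + v.2 • b 1)) / 2 =
        z * ρ * (w v - (v.1 + ρ * quad A B C v.1 v.2)) := by
      have h1 : inner ℝ (gradient u x₀) (ρ • (v.1 • b 0 + v.2 • b 1)) = z * ρ * v.1 := by
        rw [hb, inner_smul_left, inner_smul_right, inner_frame_zero]
        simp
        ring
      have h2 : inner ℝ (H (ρ • (v.1 • b 0 + v.2 • b 1))) (ρ • (v.1 • b 0 + v.2 • b 1)) / 2 =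
          z * ρ * (ρ * quad A B C v.1 v.2) := by
        simp only [map_smul, map_add, inner_smul_left, inner_smul_right, inner_add_left,
          inner_add_right, quad, A, B, C]
        simp
        field_simp
        ring
      have h3 := hwu v
      rw [framePoint] at h3
      rw [h1, h2, h3]
      ring
    rw [heq, abs_mul, abs_of_pos (show 0 < z * ρ by positivity)] at h
    have h4 : z * η * ‖ρ • (v.1 • b 0 + v.2 • b 1)‖ ^ 2 ≤ z * ρ * (ρ * η) := by
      calc z * η * ‖ρ • (v.1 • b 0 + v.2 • b 1)‖ ^ 2 ≤ z * η * ρ ^ 2 := by gcongr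
        _ = _ := by ring
    exact le_of_mul_le_mul_left (h.trans h4) (by positivity)
  set D := {v : ℝ × ℝ | v.1 ^ 2 + v.2 ^ 2 ≤ 1}
  set S := {v : ℝ × ℝ | v ∈ D ∧ |w v| ≤ κ}
  set T := {v : ℝ × ℝ | v ∈ D ∧ |w v| ≤ κ ∧ v ∉ nearCorner κ K L ρ ∧ v ≠ 0 ∧ w v ≤ ρ * (s / z)}
  have hSD : volume S ≠ ⊤ := volume_ne_top_of_subset_unitDisk fun v hv => hv.1
  have hTD : volume T ≠ ⊤ := volume_ne_top_of_subset_unitDisk fun v hv => hv.1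
  have hST : volume.real S < 2 * volume.real T := by
    refine hρarea S T (fun v hv => ⟨hv.1, ?_⟩) hTD fun v hv h1 h2 h3 h4 => ?_
    · have h1 := abs_le.1 (happrox v hv.1)
      have h2 := abs_le.1 hv.2
      exact abs_le.2 ⟨by linarith, by linarith⟩
    · have h5 := abs_le.1 (happrox v hv)
      rw [mul_sub] at h2
      exact ⟨hv, abs_le.2 ⟨by linarith, by linarith⟩, h3, h4, by linarith⟩
  have hsub : amoeba nuInf β Ω u ρ x₀ ⊆ framePoint x₀ b ρ '' S := by
    intro q hq
    obtain ⟨h1, h2⟩ := amoeba_subset hβ hρ.le hu hq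
    obtain ⟨v, rfl⟩ := exists_framePoint_eq x₀ b hρ.ne' q
    refine ⟨v, ⟨?_, (hwκ v).1 h2⟩, rfl⟩
    rw [framePoint, add_sub_cancel_left, norm_smul, Real.norm_of_nonneg hρ.le] at h1
    have h3 : ‖v.1 • b 0 + v.2 • b 1‖ ≤ 1 := le_of_mul_le_mul_left (by linarith) hρ
    have h4 := norm_frame_sq b v
    show v.1 ^ 2 + v.2 ^ 2 ≤ 1
    rw [← h4]
    exact pow_le_one₀ (norm_nonneg _) h3
  have hsup : framePoint x₀ b ρ '' T ⊆
      {x ∈ amoeba nuInf β Ω u ρ x₀ | u x ≤ u x₀ + ρ ^ 2 * s} := by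
    rintro _ ⟨v, ⟨hv, h1, h2, h3, h4⟩, rfl⟩
    refine ⟨framePoint_mem_amoeba (r := min r₁ r₂) (K := K) hβ hu hz hb
      ((Metric.ball_subset_ball (min_le_left _ _)).trans hball)
      (fun x hx => hd x (Metric.ball_subset_ball (min_le_left _ _) hx)) hK.le
      (fun h hh => by rw [hzK]; exact hlip h (hh.trans_le (min_le_right _ _))) hρ hρ1.le
      (lt_min hρr₁ hρr₂) hv h3 ((hwκ v).2 h1) (by rwa [← hκ]), ?_⟩
    have h5 : z * ρ * w v ≤ z * ρ * (ρ * (s / z)) := by gcongr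
    rw [← hwu, show z * ρ * (ρ * (s / z)) = ρ ^ 2 * s by field_simp] at h5
    linarith
  -- Monotonicity of outer measure is enough here, so measurability of the amoeba plays no role.
  refine (measure_mono hsub).trans_lt (lt_of_lt_of_le ?_ (mul_le_mul_right (measure_mono hsup) 2))
  rw [volume_framePoint_image, volume_framePoint_image, mul_left_comm]
  refine (ENNReal.mul_lt_mul_iff_right (by simpa using hρ.ne') ENNReal.ofReal_ne_top).2 ?_
  rw [← ENNReal.ofReal_toReal hSD, ← ENNReal.ofReal_toReal hTD, ← ENNReal.ofReal_ofNat,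
    ← ENNReal.ofReal_mul (by norm_num)]
  exact (ENNReal.ofReal_lt_ofReal_iff_of_nonneg measureReal_nonneg).2 hST

end Scaled

/-! ### The self-snakes operator in an adapted frame -/

section SelfSnakes

variable {u : Plane → ℝ} {x₀ : Plane} {b : OrthonormalBasis (Fin 2) ℝ Plane} {z g' : ℝ}
  {g : ℝ → ℝ} {H : Plane →L[ℝ] Plane}

theorem divergence_eq_sum_inner (F : Plane → Plane) (x : Plane)
    (b : OrthonormalBasis (Fin 2) ℝ Plane) :
    divergence F x = ∑ i, inner ℝ (b i) (fderiv ℝ F x (b i)) := by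
  have h := (fderiv ℝ F x).toLinearMap.trace_eq_sum_inner b
  rw [(fderiv ℝ F x).toLinearMap.trace_eq_sum_inner (EuclideanSpace.basisFun (Fin 2) ℝ)] at h
  refine Eq.trans (Finset.sum_congr rfl fun i _ => ?_) h
  simp [EuclideanSpace.inner_single_left]

/-- The divergence is a trace, computed in the frame adapted to the gradient. There `|∇u|` varies at
the rate `⟨H v, b 0⟩`, so `g'` meets only the second derivative along the gradient. -/
theorem selfSnakes_eq (hz : 0 < z) (hb : gradient u x₀ = z • b 0)
    (hH : HasFDerivAt (gradient u) H x₀) (hg : HasDerivAt g g' z) :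
    selfSnakes g u x₀ =
      z * g' * inner ℝ (H (b 0)) (b 0) + g z * inner ℝ (H (b 1)) (b 1) := by
  have hnorm : ‖gradient u x₀‖ = z := by
    rw [hb, norm_smul, b.orthonormal.1, mul_one, Real.norm_of_nonneg hz.le]
  have hn : HasFDerivAt (fun y => ‖gradient u y‖) ((1 / z) • (innerSL ℝ (gradient u x₀)).comp H)
      x₀ := by
    have h := (hH.norm_sq.sqrt (by rw [hnorm]; positivity))
    simp only [Real.sqrt_sq (norm_nonneg _), hnorm, Real.sqrt_sq hz.le] at h
    refine h.congr_fderiv ?_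
    ext v
    simp
    field_simp
  have hψ : HasDerivAt (fun t => g t / t) ((g' * z - g z) / z ^ 2) ‖gradient u x₀‖ := by
    rw [hnorm]
    exact (hg.div (hasDerivAt_id z) hz.ne').congr_deriv (by simp)
  have hT := (hψ.comp_hasFDerivAt x₀ hn).smul hH
  have hT' : fderiv ℝ (fun y => (g ‖gradient u y‖ / ‖gradient u y‖) • gradient u y) x₀ = _ :=
    hT.fderiv
  have h01 : inner ℝ (b 1) (b 0) = 0 := b.orthonormal.2 (by simp)
  have hbz : ‖z • b 0‖ = z := by rw [← hb, hnorm]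
  rw [selfSnakes, divergence_eq_sum_inner _ _ b, hT', hnorm, Fin.sum_univ_two]
  simp only [add_apply, smul_apply,
    ContinuousLinearMap.smulRight_apply, ContinuousLinearMap.comp_apply, innerSL_apply_apply,
    Function.comp_apply, hbz, inner_add_right, inner_smul_right, inner_smul_left,
    hb, inner_frame_self, h01, smul_eq_mul, real_inner_comm (b 0) (H (b 0)),
    real_inner_comm (b 1) (H (b 1))]
  simp
  field_simp
  ring

theorem gradient_neg (u : Plane → ℝ) (x : Plane) : gradient (-u) x = -gradient u x := by
  rw [gradient, fderiv_neg, map_neg, gradient]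

theorem selfSnakes_neg (g : ℝ → ℝ) (u : Plane → ℝ) (x : Plane) :
    selfSnakes g (-u) x = -selfSnakes g u x := by
  simp only [selfSnakes, divergence, gradient_neg, norm_neg, smul_neg, fderiv_fun_neg]
  simp
  ring

theorem exists_frame {G : Plane} (hG : G ≠ 0) :
    ∃ b : OrthonormalBasis (Fin 2) ℝ Plane, G = ‖G‖ • b 0 := by
  have hn : ‖G‖ ≠ 0 := norm_ne_zero_iff.2 hG
  have ho : Orthonormal ℝ (({0} : Set (Fin 2)).domRestrict fun _ => ‖G‖⁻¹ • G) := by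
    refine ⟨fun i => ?_, fun i j hij => absurd (Subsingleton.elim i j) hij⟩
    simp [norm_smul, hn]
  obtain ⟨b, hb⟩ := ho.exists_orthonormalBasis_extension_of_card_eq (by simp)
  exact ⟨b, by rw [hb 0 rfl, smul_inv_smul₀ hn]⟩

end SelfSnakes

/-! ### Medians -/

section Median

variable {u v : Plane → ℝ} {A : Set Plane} {m : ℝ}

theorem IsMedian.congr (h : ∀ x ∈ A, u x = v x) (hm : IsMedian u A m) : IsMedian v A m := by
  have h1 : {x ∈ A | v x < m} = {x ∈ A | u x < m} := by
    ext x
    exact and_congr_right fun hx => by rw [h x hx]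
  have h2 : {x ∈ A | m < v x} = {x ∈ A | m < u x} := by
    ext x
    exact and_congr_right fun hx => by rw [h x hx]
  rwa [IsMedian, h1, h2]

/-- Every finite measure on the real line has a median. -/
theorem exists_median (μ : Measure ℝ) [IsFiniteMeasure μ] :
    ∃ m, μ (Iio m) ≤ μ univ / 2 ∧ μ (Ioi m) ≤ μ univ / 2 := by
  rcases eq_or_ne (μ univ) 0 with h0 | h0
  · refine ⟨0, ?_, ?_⟩ <;>
    · rw [measure_mono_null (subset_univ _) h0]
      exact zero_le
  have hfin : μ univ ≠ ⊤ := measure_ne_top μ univ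
  have hhalf : μ univ / 2 < μ univ := ENNReal.half_lt_self h0 hfin
  set S := {t : ℝ | μ univ / 2 ≤ μ (Iic t)}
  have hne : S.Nonempty :=
    (((tendsto_measure_Iic_atTop μ).eventually (lt_mem_nhds hhalf)).mono fun t ht => ht.le).exists
  have hup : ∀ s ∈ S, ∀ t, s ≤ t → t ∈ S := fun s hs t hst =>
    le_trans (show μ univ / 2 ≤ μ (Iic s) from hs) (measure_mono (Iic_subset_Iic.2 hst))
  have hbdd : BddBelow S := by
    obtain ⟨a, ha⟩ : ∃ a, μ (Iic a) < μ univ / 2 := by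
      obtain ⟨a, ha⟩ := ((tendsto_measure_Ici_atBot μ).eventually (lt_mem_nhds hhalf)).exists
      refine ⟨a - 1, not_le.1 fun h => ?_⟩
      have hdisj : Disjoint (Iic (a - 1)) (Ici a) :=
        Iic_disjoint_Ici.2 (by linarith)
      have hsum := measure_mono (μ := μ) (subset_univ (Iic (a - 1) ∪ Ici a))
      rw [measure_union hdisj measurableSet_Ici] at hsum
      have hlt := ENNReal.add_lt_add_of_le_of_lt (ne_top_of_lt (hhalf.trans_le le_top)) h ha
      rw [ENNReal.add_halves] at hlt
      exact (not_lt.2 hsum) hlt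
    refine ⟨a, fun s hs => ?_⟩
    by_contra hsa
    exact (not_lt.2 (hup s hs a (not_le.1 hsa).le)) ha
  -- Both open half-lines are increasing unions of half-lines cut at points below, respectively
  -- above, the infimum.
  refine ⟨sInf S, ?_, ?_⟩
  · obtain ⟨t, ht, htlt, htlim⟩ := exists_seq_strictMono_tendsto (sInf S)
    have hU : Iio (sInf S) = ⋃ n, Iic (t n) := by
      ext x
      simp only [mem_Iio, mem_iUnion, mem_Iic]
      exact ⟨fun hx => ((htlim.eventually (lt_mem_nhds hx)).mono fun n hn => hn.le).exists,
        fun ⟨n, hn⟩ => hn.trans_lt (htlt n)⟩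
    have hmono : Monotone fun n => Iic (t n) := fun i j hij => Iic_subset_Iic.2 (ht.monotone hij)
    rw [hU]
    refine le_of_tendsto (tendsto_measure_iUnion_atTop hmono) (Eventually.of_forall fun n => ?_)
    by_contra h
    exact notMem_of_lt_csInf (htlt n) hbdd (not_le.1 h).le
  · obtain ⟨t, ht, htlt, htlim⟩ := exists_seq_strictAnti_tendsto (sInf S)
    have hU : Ioi (sInf S) = ⋃ n, Ioi (t n) := by
      ext x
      simp only [mem_Ioi, mem_iUnion]
      exact ⟨fun hx => (htlim.eventually (gt_mem_nhds hx)).exists,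
        fun ⟨n, hn⟩ => (htlt n).trans hn⟩
    have hmono : Monotone fun n => Ioi (t n) := fun i j hij => Ioi_subset_Ioi (ht.antitone hij)
    rw [hU]
    refine le_of_tendsto (tendsto_measure_iUnion_atTop hmono) (Eventually.of_forall fun n => ?_)
    obtain ⟨s, hs, hst⟩ := exists_lt_of_csInf_lt hne (htlt n)
    have htS : μ univ / 2 ≤ μ (Iic (t n)) := hup s hs _ hst.le
    show μ (Ioi (t n)) ≤ _
    rw [← compl_Iic, measure_compl measurableSet_Iic (measure_ne_top μ _)]
    refine (tsub_le_tsub_left htS _).trans_eq ?_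
    exact ENNReal.sub_half hfin

/-- A median of the image under `u` of the area restricted to `A`. Restriction is evaluated only on
measurable sublevel and superlevel sets, so `A` may be arbitrary. -/
theorem exists_isMedian_of_measurable (hu : Measurable u) (hA : volume A ≠ ⊤) :
    ∃ m, IsMedian u A m := by
  have : IsFiniteMeasure (volume.restrict A) := ⟨by simpa using hA.lt_top⟩
  obtain ⟨m, h1, h2⟩ := exists_median ((volume.restrict A).map u)
  rw [Measure.map_apply hu measurableSet_Iio, Measure.map_apply hu MeasurableSet.univ,
    Measure.restrict_apply (hu measurableSet_Iio), preimage_univ, Measure.restrict_apply_univ,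
    inter_comm] at h1
  rw [Measure.map_apply hu measurableSet_Ioi, Measure.map_apply hu MeasurableSet.univ,
    Measure.restrict_apply (hu measurableSet_Ioi), preimage_univ, Measure.restrict_apply_univ,
    inter_comm] at h2
  exact ⟨m, h1, h2⟩

theorem exists_isMedian {Ω : Set Plane} (hΩ : IsCompact Ω) (hu : ContinuousOn u Ω)
    (hA : A ⊆ Ω) : ∃ m, IsMedian u A m := by
  classical
  have hm : Measurable (Ω.piecewise u 0) :=
    hu.measurable_piecewise continuousOn_const hΩ.measurableSet
  obtain ⟨m, h⟩ := exists_isMedian_of_measurable hm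
    ((measure_mono hA).trans_lt hΩ.measure_lt_top).ne
  exact ⟨m, h.congr fun x hx => piecewise_eq_of_mem _ _ _ (hA hx)⟩

theorem IsMedian.le_of_volume_lt {s : ℝ} (hm : IsMedian u A m)
    (h : volume A < 2 * volume {x ∈ A | u x ≤ s}) : m ≤ s := by
  by_contra! hs
  have h1 : volume {x ∈ A | u x ≤ s} ≤ volume A / 2 :=
    (measure_mono (fun x hx => ⟨hx.1, hx.2.trans_lt hs⟩ :
      {x ∈ A | u x ≤ s} ⊆ {x ∈ A | u x < m})).trans hm.1
  refine (not_le.2 h) ((mul_le_mul_right h1 2).trans_eq ?_)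
  exact ENNReal.mul_div_cancel (by norm_num) (by norm_num)

theorem IsMedian.neg (hm : IsMedian u A m) : IsMedian (-u) A (-m) := by
  simpa only [IsMedian, Pi.neg_apply, neg_lt_neg_iff] using hm.symm

end Median

/-! ### The edge-stopping function of the maximum amoeba metric -/

section EdgeStopping

variable {β : ℝ} {Ω : Set Plane} {u : Plane → ℝ} {x₀ : Plane} {g : ℝ → ℝ}

theorem eventually_volume_amoeba_lt_of_selfSnakes_lt (hβ : 0 < β) (hu : ContDiffOn ℝ ∞ u Ω)
    (hx : x₀ ∈ interior Ω) (hG : gradient u x₀ ≠ 0) {s : ℝ}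
    (hs : selfSnakes (gInf β) u x₀ / 6 < s) :
    ∀ᶠ ρ : ℝ in 𝓝[>] 0, volume (amoeba nuInf β Ω u ρ x₀) <
      2 * volume {x ∈ amoeba nuInf β Ω u ρ x₀ | u x ≤ u x₀ + ρ ^ 2 * s} := by
  obtain ⟨b, hb⟩ := exists_frame hG
  have hz : 0 < ‖gradient u x₀‖ := norm_pos_iff.2 hG
  set z := ‖gradient u x₀‖
  have hH := (differentiableAt_gradient (contDiffAt_of_mem_interior hu hx)).hasFDerivAt
  refine eventually_volume_amoeba_lt hβ hu hx hz hb hH rfl (lt_of_eq_of_lt ?_ hs)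
  -- With `κ = 1/(βz)` one has `gInf = 1 - Y³` and `z gInf' = -3 κ² Y`, exactly the two coefficients
  -- of the median.
  rw [selfSnakes_eq hz hb hH (hasDerivAt_gInf hβ hz), gInf_eq hβ hz]
  have hκ : (1 / (β * z)) ^ 2 = 1 / (β ^ 2 * z ^ 2) := by
    rw [div_pow, one_pow, mul_pow]
  rw [hκ]
  field_simp
  ring

theorem approximatesTimeStep_gInf (hβ : 0 < β) (hΩ : IsCompact Ω) (hu : ContDiffOn ℝ ∞ u Ω)
    (hx : x₀ ∈ interior Ω) (hG : gradient u x₀ ≠ 0) :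
    ApproximatesTimeStep nuInf β Ω u x₀ (selfSnakes (gInf β) u x₀) := by
  intro ε hε
  set R := selfSnakes (gInf β) u x₀
  have h1 := eventually_volume_amoeba_lt_of_selfSnakes_lt hβ hu hx hG
    (show R / 6 < R / 6 + ε by linarith)
  have h2 := eventually_volume_amoeba_lt_of_selfSnakes_lt hβ hu.neg hx
    (show gradient (-u) x₀ ≠ 0 by rwa [gradient_neg, neg_ne_zero])
    (show selfSnakes (gInf β) (-u) x₀ / 6 < -R / 6 + ε by rw [selfSnakes_neg]; linarith)
  filter_upwards [h1, h2] with ρ h1 h2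
  refine ⟨exists_isMedian hΩ hu.continuousOn fun x hx => hx.1, fun m hm => ?_⟩
  change volume (amoeba nuInf β Ω (-u) ρ x₀) <
    2 * volume {x ∈ amoeba nuInf β Ω (-u) ρ x₀ | (-u) x ≤ -u x₀ + ρ ^ 2 * (-R / 6 + ε)} at h2
  rw [amoeba_neg] at h2
  have h3 := hm.le_of_volume_lt h1
  have h4 := hm.neg.le_of_volume_lt h2
  rw [abs_le]
  constructor <;> linarith

/-- A common median exists for some small `ρ`. Two errors of `|r - s| ρ² / 24` cannot bridge the gap
`|r - s| ρ² / 6`. -/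
theorem ApproximatesTimeStep.eq {ν : ℝ → ℝ} {r s : ℝ} (hr : ApproximatesTimeStep ν β Ω u x₀ r)
    (hs : ApproximatesTimeStep ν β Ω u x₀ s) : r = s := by
  by_contra hne
  have hpos : 0 < |r - s| := abs_pos.2 (sub_ne_zero.2 hne)
  obtain ⟨ρ, ⟨h1, h2⟩, hρ⟩ := ((hr (|r - s| / 24) (by positivity)).and
    (hs (|r - s| / 24) (by positivity)) |>.and self_mem_nhdsWithin).exists
  obtain ⟨m, hm⟩ := h1.1
  have h3 := abs_sub_le (u x₀ + ρ ^ 2 / 6 * r) m (u x₀ + ρ ^ 2 / 6 * s)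
  rw [abs_sub_comm _ m] at h3
  have h4 : |u x₀ + ρ ^ 2 / 6 * r - (u x₀ + ρ ^ 2 / 6 * s)| = ρ ^ 2 * (|r - s| / 6) := by
    rw [show u x₀ + ρ ^ 2 / 6 * r - (u x₀ + ρ ^ 2 / 6 * s) = ρ ^ 2 * ((r - s) / 6) by ring,
      abs_mul, abs_of_nonneg (sq_nonneg ρ), abs_div, abs_of_pos (show (0 : ℝ) < 6 by norm_num)]
  have hρ2 : 0 < ρ ^ 2 * |r - s| := mul_pos (pow_pos hρ 2) hpos
  have h5 := h1.2 m hm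
  have h6 := h2.2 m hm
  linarith

theorem selfSnakes_congr {g₁ g₂ : ℝ → ℝ} (h : ∀ z, 0 ≤ z → g₁ z = g₂ z) (u : Plane → ℝ) :
    selfSnakes g₁ u = selfSnakes g₂ u := by
  ext x
  simp only [selfSnakes, h _ (norm_nonneg _)]

theorem isEdgeStoppingFunction_gInf (hβ : 0 < β) (hg : ∀ z, 0 ≤ z → g z = gInf β z) :
    IsEdgeStoppingFunction nuInf β g where
  nonneg z hz := by
    rw [hg z hz]
    exact gInf_nonneg hβ hz
  antitoneOn := (antitoneOn_gInf hβ).congr fun z hz => (hg z hz).symm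
  continuousOn := ContinuousOn.congr
    (fun _ hz => (continuousAt_gInf hβ hz).continuousWithinAt) fun z hz => hg z hz
  differentiableOn := DifferentiableOn.congr
    (fun _ hz => (hasDerivAt_gInf hβ hz).differentiableAt.differentiableWithinAt)
    fun z hz => hg z (le_of_lt hz)
  approximates Ω u hΩ _ hu x₀ hx hG := by
    rw [selfSnakes_congr hg]
    exact approximatesTimeStep_gInf hβ hΩ hu hx hG

/-- An image whose level line through the origin is curved and whose gradient has constant norm
to first order across the level line. -/
noncomputable def parabolicImage (z : ℝ) (x : Plane) : ℝ := z * x 0 + x 1 ^ 2 / 2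

theorem contDiff_parabolicImage (z : ℝ) : ContDiff ℝ ∞ (parabolicImage z) := by
  unfold parabolicImage
  fun_prop

theorem gradient_parabolicImage (z : ℝ) (x : Plane) : gradient (parabolicImage z) x =
    z • EuclideanSpace.single 0 1 + x 1 • EuclideanSpace.single 1 1 := by
  have h (i : Fin 2) : HasFDerivAt (fun x : Plane => x i) (EuclideanSpace.proj i : Plane →L[ℝ] ℝ) x :=
    (EuclideanSpace.proj i : Plane →L[ℝ] ℝ).hasFDerivAt
  have hd : HasFDerivAt (parabolicImage z) _ x :=
    ((h 0).const_mul z).add (((h 1).pow 2).mul_const (1 / 2)) |>.congr_of_eventuallyEq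
      (Eventually.of_forall fun y => by simp [parabolicImage]; ring)
  ext i
  rw [gradient_apply, hd.fderiv]
  fin_cases i <;> simp

/-- The second derivative along the gradient vanishes at the origin, which removes `g'`; the one
along the level line is `1`. -/
theorem selfSnakes_parabolicImage {z : ℝ} (hz : 0 < z) (hg : DifferentiableAt ℝ g z) :
    selfSnakes g (parabolicImage z) 0 = g z := by
  have hH : HasFDerivAt (gradient (parabolicImage z))
      ((EuclideanSpace.proj 1 : Plane →L[ℝ] ℝ).smulRight
        (EuclideanSpace.single 1 1 : Plane)) 0 := by
    rw [show gradient (parabolicImage z) = _ from funext (gradient_parabolicImage z)]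
    exact ((EuclideanSpace.proj 1 : Plane →L[ℝ] ℝ).smulRight
      (EuclideanSpace.single 1 1 : Plane)).hasFDerivAt.const_add _
  rw [selfSnakes_eq (b := EuclideanSpace.basisFun (Fin 2) ℝ) hz
    (by rw [gradient_parabolicImage]; simp) hH hg.hasDerivAt]
  simp

theorem IsEdgeStoppingFunction.eq_gInf_of_pos (hβ : 0 < β)
    (hg : IsEdgeStoppingFunction nuInf β g) {z : ℝ} (hz : 0 < z) : g z = gInf β z := by
  have h0 : (0 : Plane) ∈ interior (Metric.closedBall 0 1) :=
    Metric.ball_subset_interior_closedBall (Metric.mem_ball_self one_pos)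
  have hG : gradient (parabolicImage z) 0 ≠ 0 := by
    rw [gradient_parabolicImage]
    simp [hz.ne']
  have hu : ContDiffOn ℝ ∞ (parabolicImage z) (Metric.closedBall 0 1) :=
    (contDiff_parabolicImage z).contDiffOn
  have hΩ : IsCompact (Metric.closedBall (0 : Plane) 1) := isCompact_closedBall 0 1
  have hconn : IsConnected (Metric.closedBall (0 : Plane) 1) :=
    (convex_closedBall 0 1).isConnected ⟨0, by simp⟩
  have h1 := hg.approximates _ _ hΩ hconn hu 0 h0 hG
  have h2 := approximatesTimeStep_gInf hβ hΩ hu h0 hG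
  rw [selfSnakes_parabolicImage hz
    ((hg.differentiableOn z hz).differentiableAt (Ioi_mem_nhds hz))] at h1
  rw [selfSnakes_parabolicImage hz (hasDerivAt_gInf hβ hz).differentiableAt] at h2
  exact h1.eq h2

theorem IsEdgeStoppingFunction.eq_gInf (hβ : 0 < β) (hg : IsEdgeStoppingFunction nuInf β g)
    {z : ℝ} (hz : 0 ≤ z) : g z = gInf β z := by
  rcases hz.eq_or_lt with rfl | hz
  -- Points with zero gradient are never tested, so the value at `0` comes from continuity.
  · have h1 : Tendsto g (𝓝[>] 0) (𝓝 (g 0)) :=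
      (hg.continuousOn 0 self_mem_Ici).mono_left (nhdsWithin_mono 0 Ioi_subset_Ici_self)
    have h2 : Tendsto (gInf β) (𝓝[>] 0) (𝓝 (gInf β 0)) :=
      (continuousAt_gInf hβ le_rfl).tendsto.mono_left nhdsWithin_le_nhds
    refine tendsto_nhds_unique (h1.congr' ?_) h2
    filter_upwards [self_mem_nhdsWithin] with w hw
    exact hg.eq_gInf_of_pos hβ hw
  · exact hg.eq_gInf_of_pos hβ hz

end EdgeStopping

end Amoeba

theorem mainTheorem4 (β : ℝ) (hβ : 0 < β) :
    (∀ g : ℝ → ℝ, Amoeba.IsEdgeStoppingFunction Amoeba.nuInf β g ↔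
      ∀ z : ℝ, 0 ≤ z → g z = Amoeba.gInf β z) ∧
    (∀ z : ℝ, 0 < z →
      IntervalIntegrable (Amoeba.nuIntegrand Amoeba.nuInf β z) MeasureTheory.volume 0 1 ∧
      Amoeba.gInf β z =
        3 / (β ^ 2 * z ^ 2 * Amoeba.nuInf (1 / (β * z)) ^ 3) *
          ∫ ξ in (0 : ℝ)..1, Amoeba.nuIntegrand Amoeba.nuInf β z ξ) :=
  ⟨fun _ => ⟨fun hg _ hz => hg.eq_gInf hβ hz, Amoeba.isEdgeStoppingFunction_gInf hβ⟩,
    fun z hz => ⟨Amoeba.intervalIntegrable_nuIntegrand β z, Amoeba.gInf_eq_integral hβ hz⟩⟩
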